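/- Let $1\le \ell\le n$ and let $\theta\in C^\infty_0(\mathbb R^n)$ be a real-valued function with $\int\theta\,dx=1$. For forms $u$ on $\mathbb R^n$ of degree $\ell$ define $$R_\ell u(x)=\int G_{n-\ell+1}(y,x)\,(x-y)\lrcorner u(y)\,dy,\qquad T_\ell u(x)=\int G_{\ell}(x,y)\,(x-y)\lrcorner u(y)\,dy,$$ where $G_k(x,y)=\int_1^\infty (t-1)^{n-k}t^{k-1}\,\theta\bigl(y+t(x-y)\bigr)\,dt$ for $1\le k\le n$ and $\lrcorner$ is the contraction of an alternating form with a vector. Let $\Lambda^\ell$ be the space of alternating $\ell$-forms on $\mathbb R^n$. Then the integrals defining $R_\ell u(x)$ and $T_\ell u(x)$ converge absolutely for $u$ in the spaces below and the operators define continuous linear maps $$R_\ell: C^\infty(\mathbb R^n,\Lambda^\ell)\to C^\infty(\mathbb R^n,\Lambda^{\ell-1}),\qquad T_\ell: C^\infty_0(\mathbb R^n,\Lambda^\ell)\to C^\infty_0(\mathbb R^n,\Lambda^{\ell-1}).$$ If moreover $\Omega\subset\mathbb R^n$ is a bounded domain and $B\supset\operatorname{supp}\theta$ is a (open or closed) ball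 such that $\Omega$ is starlike with respect to $B$, i.e. for every $x\in\Omega$ the convex hull of $\{x\}\cup B$ is contained in $\Omega$, then they define continuous linear maps $$R_\ell: C^\infty(\Omega,\Lambda^\ell)\to C^\infty(\Omega,\Lambda^{\ell-1}),\qquad R_\ell: C^\infty(\overline\Omega,\Lambda^\ell)\to C^\infty(\overline\Omega,\Lambda^{\ell-1}),$$ $$T_\ell: C^\infty_0(\Omega,\Lambda^\ell)\to C^\infty_0(\Omega,\Lambda^{\ell-1}),\qquad T_\ell: C^\infty_{\overline\Omega}(\mathbb R^n,\Lambda^\ell)\to C^\infty_{\overline\Omega}(\mathbb R^n,\Lambda^{\ell-1}).$$ For $u$ given only on $\Omega$, $R_\ell u(x)$, $x\in\Omega$, is given by the same formula with the integral taken over $\Omega$. Here $C^\infty(\Omega)$ is the space of smooth functions on $\Omega$ and $C^\infty(\mathbb R^n)$ is the case $\Omega=\mathbb R^n$, both with the topology of uniform convergence of all derivatives on compact subsets; $C^\infty_0(\Omega)$ (in particular $C^\infty_0(\mathbb R^n)$) is the space of smooth functions with compact support in $\Omega$, with its locally convex inductive limit topology; $C^\infty(\overline\Omega)$ is the space of restrictions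 to $\Omega$ of functions in $C^\infty(\mathbb R^n)$, with the quotient topology from $C^\infty(\mathbb R^n)$; and $C^\infty_{\overline\Omega}(\mathbb R^n)$ is the space of functions in $C^\infty(\mathbb R^n)$ with support in $\overline\Omega$, with the subspace topology. -/

import Mathlib

open MeasureTheory TopologicalSpace
open scoped ContDiff Distributions Topology

noncomputable section SmoothSpaces

variable {E : Type*} [NormedAddCommGroup E] [NormedSpace ℝ E]

/-- The functions of class `C^∞` on the open set `U`. A function on `U` is represented by its
extension by zero to the whole space, so that equality of elements is equality on `U`. -/
def smoothSubmodule (U : Opens E) (F : Type*) [NormedAddCommGroup F] [NormedSpace ℝ F] :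
    Submodule ℝ (E → F) where
  carrier := {f | ContDiffOn ℝ ∞ f U ∧ ∀ x, x ∉ U → f x = 0}
  add_mem' := fun ha hb => ⟨ha.1.add hb.1, fun x hx => by simp [ha.2 x hx, hb.2 x hx]⟩
  zero_mem' := ⟨contDiffOn_const, fun _ _ => rfl⟩
  smul_mem' := fun c _ ha => ⟨ha.1.const_smul c, fun x hx => by simp [ha.2 x hx]⟩

/-- The space `C^∞(U, F)` of smooth functions on an open set `U`
(a type of its own, so that it carries only the topology defined below). -/
def SmoothOn (U : Opens E) (F : Type*) [NormedAddCommGroup F] [NormedSpace ℝ F] : Type _ :=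
  smoothSubmodule U F

namespace SmoothOn

variable {U : Opens E} {F : Type*} [NormedAddCommGroup F] [NormedSpace ℝ F]

instance : AddCommGroup (SmoothOn U F) := inferInstanceAs (AddCommGroup (smoothSubmodule U F))

instance : Module ℝ (SmoothOn U F) := inferInstanceAs (Module ℝ (smoothSubmodule U F))

instance : CoeFun (SmoothOn U F) (fun _ => E → F) := ⟨fun u => u.1⟩

theorem contDiffOn (u : SmoothOn U F) : ContDiffOn ℝ ∞ u U := u.2.1

theorem continuousOn_iteratedFDeriv (u : SmoothOn U F) (m : ℕ) :
    ContinuousOn (iteratedFDeriv ℝ m u) U := by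
  have h := u.contDiffOn.continuousOn_iteratedFDerivWithin (m := m)
    (by exact_mod_cast le_top) U.isOpen.uniqueDiffOn
  exact h.congr fun x hx => (iteratedFDerivWithin_of_isOpen m U.isOpen hx).symm

/-- The derivative of order `m` of a smooth function on `U`, as a continuous function on `U`. -/
def iterDeriv (m : ℕ) (u : SmoothOn U F) :
    C(U, ContinuousMultilinearMap ℝ (fun _ : Fin m => E) F) :=
  ⟨fun x => iteratedFDeriv ℝ m u x, (u.continuousOn_iteratedFDeriv m).domRestrict⟩

/-- The standard topology of `C^∞(U, F)`: locally uniform (compact-open) convergence on `U` of the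
derivatives of every order. -/
instance : TopologicalSpace (SmoothOn U F) :=
  ⨅ m : ℕ, TopologicalSpace.induced (iterDeriv m) ContinuousMap.compactOpen

/-- Restriction of smooth functions on the whole space to the open set `U`. -/
def restrict (U : Opens E) : SmoothOn (⊤ : Opens E) F →ₗ[ℝ] SmoothOn U F where
  toFun u := ⟨(U : Set E).indicator u,
    ((u.contDiffOn.mono (Set.subset_univ _)).congr fun _ hx => Set.indicator_of_mem hx _),
    fun _ hx => Set.indicator_of_notMem hx _⟩
  map_add' u v := Subtype.ext (Set.indicator_add (U : Set E) u.1 v.1)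
  map_smul' c u := Subtype.ext (Set.indicator_const_smul (U : Set E) c u.1)

end SmoothOn

/-- The space `C^∞(closure U, F)`: the smooth functions on `U` that are restrictions to `U` of
smooth functions on the whole space. -/
def SmoothUpToBoundary (U : Opens E) (F : Type*) [NormedAddCommGroup F] [NormedSpace ℝ F] :
    Type _ :=
  LinearMap.range (SmoothOn.restrict (F := F) U)

namespace SmoothUpToBoundary

variable {U : Opens E} {F : Type*} [NormedAddCommGroup F] [NormedSpace ℝ F]

instance : AddCommGroup (SmoothUpToBoundary U F) :=
  inferInstanceAs (AddCommGroup (LinearMap.range (SmoothOn.restrict (F := F) U)))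

instance : Module ℝ (SmoothUpToBoundary U F) :=
  inferInstanceAs (Module ℝ (LinearMap.range (SmoothOn.restrict (F := F) U)))

/-- An element as a function, again extended by zero outside `U`. -/
instance : CoeFun (SmoothUpToBoundary U F) (fun _ => E → F) := ⟨fun u => u.1⟩

/-- Restriction as a map onto `C^∞(closure U, F)`. -/
def restrict (U : Opens E) : SmoothOn (⊤ : Opens E) F →ₗ[ℝ] SmoothUpToBoundary U F :=
  (SmoothOn.restrict (F := F) U).rangeRestrict

/-- The topology of `C^∞(closure U, F)` as the quotient of the space of smooth functions on the
whole space by the functions vanishing on `U`. -/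
instance : TopologicalSpace (SmoothUpToBoundary U F) :=
  TopologicalSpace.coinduced (restrict U) inferInstance

end SmoothUpToBoundary

/-- `Ω` is starlike with respect to `B`: for every `x ∈ Ω`, the convex hull of `{x} ∪ B` is
contained in `Ω`. -/
def IsStarlike (Ω B : Set E) : Prop :=
  ∀ x ∈ Ω, convexHull ℝ ({x} ∪ B) ⊆ Ω

end SmoothSpaces

noncomputable section Operators

/-- The alternating `ℓ`-forms on `ℝ^n`. -/
abbrev AltForm (n ℓ : ℕ) : Type :=
  ContinuousAlternatingMap ℝ (EuclideanSpace ℝ (Fin n)) ℝ (Fin ℓ)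

variable {n ℓ : ℕ}

/-- The kernel `G_ℓ(x, y) = ∫_1^∞ (t - 1)^(n - ℓ) t^(ℓ - 1) θ(y + t (x - y)) dt`. -/
def kernelG (θ : EuclideanSpace ℝ (Fin n) → ℝ) (ℓ : ℤ) (x y : EuclideanSpace ℝ (Fin n)) : ℝ :=
  ∫ t in Set.Ioi (1 : ℝ), (t - 1) ^ ((n : ℤ) - ℓ) * t ^ (ℓ - 1) * θ (y + t • (x - y))

/-- The integrand `y ↦ G_{n-ℓ+1}(y, x) (x - y) ⌟ u(y)` of the Poincaré-type operator applied to the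
form `u` of degree `ℓ` (the degree is written `ℓ + 1` here). The contraction of a form with a
vector is the insertion of the vector in the first argument. -/
def poincareIntegrand (θ : EuclideanSpace ℝ (Fin n) → ℝ)
    (u : EuclideanSpace ℝ (Fin n) → AltForm n (ℓ + 1)) (x y : EuclideanSpace ℝ (Fin n)) :
    AltForm n ℓ :=
  kernelG θ ((n : ℤ) - ((ℓ + 1 : ℕ) : ℤ) + 1) y x • (u y).curryLeft (x - y)

/-- The integrand `y ↦ G_ℓ(x, y) (x - y) ⌟ u(y)` of the Bogovskii-type operator applied to the
form `u` of degree `ℓ` (the degree is written `ℓ + 1` here). -/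
def bogovskiiIntegrand (θ : EuclideanSpace ℝ (Fin n) → ℝ)
    (u : EuclideanSpace ℝ (Fin n) → AltForm n (ℓ + 1)) (x y : EuclideanSpace ℝ (Fin n)) :
    AltForm n ℓ :=
  kernelG θ ((ℓ + 1 : ℕ) : ℤ) x y • (u y).curryLeft (x - y)

/-- The Poincaré-type integral operator `R_ℓ` (on forms of degree `ℓ + 1` here). -/
def poincareOp (θ : EuclideanSpace ℝ (Fin n) → ℝ)
    (u : EuclideanSpace ℝ (Fin n) → AltForm n (ℓ + 1)) (x : EuclideanSpace ℝ (Fin n)) :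
    AltForm n ℓ :=
  ∫ y, poincareIntegrand θ u x y

/-- The Bogovskii-type integral operator `T_ℓ` (on forms of degree `ℓ + 1` here). -/
def bogovskiiOp (θ : EuclideanSpace ℝ (Fin n) → ℝ)
    (u : EuclideanSpace ℝ (Fin n) → AltForm n (ℓ + 1)) (x : EuclideanSpace ℝ (Fin n)) :
    AltForm n ℓ :=
  ∫ y, bogovskiiIntegrand θ u x y

end Operators

/-! ### Smooth dependence on a parameter of integrals over a compact set. -/

section ParametricIntegral

/-! The kernels are singular at `y = x`, but a change of variables removes the singularity. Write `n
= k + ℓ + 1`, the form having degree `ℓ + 1`, and expand the kernel to get an integral in `(t, y)`.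
For `R`, substitute `z = x + t (y - x)` and then `s = 1/t`. The Jacobian `t⁻ⁿ`, the factor `t⁻¹`
from `x - y = t⁻¹ (x - z)` and the weight `t^k (t - 1)^ℓ` combine to `(1 - s)^ℓ t⁻²`, and `t⁻² dt`
becomes `ds`. Hence `R u(x) = ∫_{[0,1] × supp θ} (1 - s)^ℓ θ(z) (x - z) ⌟ u(x + s (z - x))`, a
regular integral over a compact set; the factor `t⁻²` also gives absolute convergence
(`integrable_rayIntegrand`, `integral_rayIntegrand`).

For `T`, cut at `t = 2`. On `1 < t ≤ 2` the integrand is smooth in `x`, and `y` stays in the compact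
support of `u`. On `t > 2`, shifting `t` by one gives the integral of `R` along the opposite ray,
with sign `ε = -1`, so the same substitution applies (`integral_backwardIntegrand`).

Every term is thus of the form `∫_K Ψ(x, p) u(a(p) + s(p) x) dp` with `K` compact and `Ψ`, `a`, `s`
smooth. Differentiation under the integral and the Leibniz rule give smoothness, and bound
derivatives of order `m` by those of `u` up to order `m`
(`exists_norm_iteratedFDeriv_affineSuperposition_le`). This is continuity in each of the topologies,
once supports are controlled: a kernel vanishes unless one of its points lies on a segment from the
other to `supp θ` (`exists_of_kernelG_ne_zero`), and starlikeness keeps such segments in `Ω`. -/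

theorem exists_nhds_bound_of_continuousOn {E P H : Type*} [NormedAddCommGroup E]
    [ProperSpace E] [TopologicalSpace P] [SeminormedAddCommGroup H]
    {g : E × P → H} {V : Set E} {K : Set P}
    (hV : IsOpen V) (hK : IsCompact K) (hg : ContinuousOn g (V ×ˢ K)) {x : E} (hx : x ∈ V) :
    ∃ r > 0, Metric.ball x r ⊆ V ∧ ∃ C, ∀ y ∈ Metric.ball x r, ∀ p ∈ K, ‖g (y, p)‖ ≤ C := by
  obtain ⟨r, hr, hrV⟩ := Metric.nhds_basis_closedBall.mem_iff.1 (hV.mem_nhds hx)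
  obtain ⟨C, hC⟩ := ((isCompact_closedBall x r).prod hK).exists_bound_of_continuousOn
    (hg.mono (Set.prod_mono hrV le_rfl))
  exact ⟨r, hr, Metric.ball_subset_closedBall.trans hrV, C, fun y hy p hp =>
    hC _ ⟨Metric.ball_subset_closedBall hy, hp⟩⟩

variable {E E' F G P : Type*} [NormedAddCommGroup E] [NormedSpace ℝ E]
  [NormedAddCommGroup E'] [NormedSpace ℝ E'] [NormedAddCommGroup F] [NormedSpace ℝ F]
  [NormedAddCommGroup G] [NormedSpace ℝ G] [NormedAddCommGroup P] [NormedSpace ℝ P]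

theorem iteratedFDeriv_comp_affine {f : E' → F} {s : Set E'} (hs : IsOpen s)
    (hf : ContDiffOn ℝ ∞ f s) (L : E →L[ℝ] E') (b : E') {x : E} (hx : L x + b ∈ s) (i : ℕ) :
    iteratedFDeriv ℝ i (fun x => f (L x + b)) x =
      (iteratedFDeriv ℝ i f (L x + b)).compContinuousLinearMap fun _ => L := by
  set t : Set E' := (fun z => z + b) ⁻¹' s with ht
  have hto : IsOpen t := hs.preimage (by fun_prop)
  have hg : ContDiffOn ℝ ∞ (fun z => f (z + b)) t :=
    hf.comp (contDiff_id.add contDiff_const).contDiffOn fun z hz => hz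
  have hto' : IsOpen (L ⁻¹' t) := hto.preimage L.continuous
  have h := L.iteratedFDerivWithin_comp_right hg hto.uniqueDiffOn hto'.uniqueDiffOn (x := x) hx
    (i := i) (by exact_mod_cast le_top)
  rw [iteratedFDerivWithin_of_isOpen i hto' hx, iteratedFDerivWithin_of_isOpen i hto hx,
    iteratedFDeriv_comp_add_right] at h
  exact h

/-- The partial derivative in `x` is the full derivative of `f` composed with the inclusion of the
first factor, hence jointly continuous. -/
theorem continuousOn_iteratedFDeriv_left {f : E × P → G} {W : Set (E × P)} (hW : IsOpen W)
    (hf : ContDiffOn ℝ ∞ f W) (m : ℕ) :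
    ContinuousOn (fun q : E × P => iteratedFDeriv ℝ m (fun x => f (x, q.2)) q.1) W := by
  have h1 : ContinuousOn (iteratedFDeriv ℝ m f) W :=
    (hf.continuousOn_iteratedFDerivWithin (m := m) (by exact_mod_cast le_top)
      hW.uniqueDiffOn).congr fun x hx => (iteratedFDerivWithin_of_isOpen m hW hx).symm
  have h2 := (ContinuousMultilinearMap.compContinuousLinearMapL (𝕜 := ℝ) (F := G)
    fun _ : Fin m => ContinuousLinearMap.inl ℝ E P).continuous.comp_continuousOn h1
  refine h2.congr fun q hq => ?_
  have h3 := iteratedFDeriv_comp_affine hW hf (ContinuousLinearMap.inl ℝ E P) (0, q.2)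
    (x := q.1) (by simpa using hq) m
  simpa using h3

variable [FiniteDimensional ℝ E] [CompleteSpace G] [MeasurableSpace P] [BorelSpace P]
  {μ : Measure P} [IsFiniteMeasureOnCompacts μ]

/-- Differentiation under the integral at each order: the next derivative is bounded on a small ball
times `K` by compactness, and this constant is the dominating function. -/
theorem hasFTaylorSeriesUpToOn_setIntegral {f : E × P → G} {W : Set (E × P)} (hW : IsOpen W)
    (hf : ContDiffOn ℝ ∞ f W) {V : Set E} (hV : IsOpen V) {K : Set P} (hK : IsCompact K)
    (hVK : V ×ˢ K ⊆ W) :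
    HasFTaylorSeriesUpToOn ∞ (fun x => ∫ p in K, f (x, p) ∂μ)
      (fun x m => ∫ p in K, iteratedFDeriv ℝ m (fun x => f (x, p)) x ∂μ) V := by
  have hcont (m : ℕ) := (continuousOn_iteratedFDeriv_left hW hf m).mono hVK
  have hcontx (m : ℕ) {x : E} (hx : x ∈ V) :
      ContinuousOn (fun p => iteratedFDeriv ℝ m (fun x => f (x, p)) x) K :=
    (hcont m).comp (f := fun p => (x, p)) (by fun_prop) fun p hp => ⟨hx, hp⟩
  have hint (m : ℕ) {x : E} (hx : x ∈ V) :
      IntegrableOn (fun p => iteratedFDeriv ℝ m (fun x => f (x, p)) x) K μ :=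
    (hcontx m hx).integrableOn_compact hK
  have hderiv (m : ℕ) {x : E} (hx : x ∈ V) :
      HasFDerivAt (fun x => ∫ p in K, iteratedFDeriv ℝ m (fun x => f (x, p)) x ∂μ)
        (∫ p in K, (iteratedFDeriv ℝ (m + 1) (fun x => f (x, p)) x).curryLeft ∂μ) x := by
    obtain ⟨r, hr, hrV, C, hC⟩ := exists_nhds_bound_of_continuousOn hV hK (hcont (m + 1)) hx
    refine hasFDerivAt_integral_of_dominated_of_fderiv_le (bound := fun _ => C)
      (F := fun x p => iteratedFDeriv ℝ m (fun x => f (x, p)) x)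
      (F' := fun x p => (iteratedFDeriv ℝ (m + 1) (fun x => f (x, p)) x).curryLeft)
      (Metric.ball_mem_nhds x hr) ?_ (hint m hx) ?_ ?_ ?_ ?_
    · filter_upwards [hV.mem_nhds hx] with y hy using (hint m hy).aestronglyMeasurable
    · exact ((continuousMultilinearCurryLeftEquiv ℝ (fun _ : Fin (m + 1) => E) G).continuous
        |>.comp_continuousOn (hcontx (m + 1) hx)).integrableOn_compact hK |>.aestronglyMeasurable
    · filter_upwards [ae_restrict_mem hK.measurableSet] with p hp y hy
      rw [ContinuousMultilinearMap.curryLeft_norm]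
      exact hC y hy p hp
    · exact integrableOn_const hK.measure_lt_top.ne
    · filter_upwards [ae_restrict_mem hK.measurableSet] with p hp y hy
      have hfp : ContDiffAt ℝ ∞ (fun x => f (x, p)) y :=
        (hf.contDiffAt (hW.mem_nhds (hVK ⟨hrV hy, hp⟩))).comp y (by fun_prop)
      have := (hfp.differentiableAt_iteratedFDeriv (m := m)
        (by exact_mod_cast ENat.natCast_lt_top m)).hasFDerivAt
      rwa [fderiv_iteratedFDeriv] at this
  refine ⟨fun x hx => ?_, fun m _ x hx => ?_, fun m _ x hx => ?_⟩
  · have := (continuousMultilinearCurryFin0 ℝ E G).toContinuousLinearEquiv.integral_comp_comm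
      (μ := μ.restrict K) (fun p => iteratedFDeriv ℝ 0 (fun x => f (x, p)) x)
    exact this.symm
  · let L : (E [×(m + 1)]→L[ℝ] G) ≃L[ℝ] (E →L[ℝ] (E [×m]→L[ℝ] G)) :=
      (continuousMultilinearCurryLeftEquiv ℝ (fun _ : Fin (m + 1) => E) G).toContinuousLinearEquiv
    have := ContinuousLinearMap.integral_comp_comm (𝕜 := ℝ) (E := E [×(m + 1)]→L[ℝ] G)
      (Fₗ := E →L[ℝ] (E [×m]→L[ℝ] G)) (L : (E [×(m + 1)]→L[ℝ] G) →L[ℝ] (E →L[ℝ] (E [×m]→L[ℝ] G)))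
      (hint (m + 1) hx)
    convert (hderiv m hx).hasFDerivWithinAt using 1
    exact this.symm
  · exact (hderiv m hx).continuousAt.continuousWithinAt

theorem contDiffOn_setIntegral {f : E × P → G} {W : Set (E × P)} (hW : IsOpen W)
    (hf : ContDiffOn ℝ ∞ f W) {V : Set E} (hV : IsOpen V) {K : Set P} (hK : IsCompact K)
    (hVK : V ×ˢ K ⊆ W) : ContDiffOn ℝ ∞ (fun x => ∫ p in K, f (x, p) ∂μ) V :=
  (hasFTaylorSeriesUpToOn_setIntegral hW hf hV hK hVK).contDiffOn

theorem iteratedFDeriv_setIntegral {f : E × P → G} {W : Set (E × P)} (hW : IsOpen W)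
    (hf : ContDiffOn ℝ ∞ f W) {V : Set E} (hV : IsOpen V) {K : Set P} (hK : IsCompact K)
    (hVK : V ×ˢ K ⊆ W) (m : ℕ) {x : E} (hx : x ∈ V) :
    iteratedFDeriv ℝ m (fun x => ∫ p in K, f (x, p) ∂μ) x =
      ∫ p in K, iteratedFDeriv ℝ m (fun x => f (x, p)) x ∂μ := by
  rw [← iteratedFDerivWithin_of_isOpen m hV hx]
  exact ((hasFTaylorSeriesUpToOn_setIntegral hW hf hV hK
    hVK).eq_iteratedFDerivWithin_of_uniqueDiffOn (by exact_mod_cast le_top) hV.uniqueDiffOn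
      hx).symm

end ParametricIntegral

/-! ### Operators integrating `u` along a compact family of affine maps. -/

section AffineSuperposition

variable {E F G P : Type*} [NormedAddCommGroup E] [NormedSpace ℝ E]
  [NormedAddCommGroup F] [NormedSpace ℝ F] [NormedAddCommGroup G] [NormedSpace ℝ G]
  [NormedAddCommGroup P] [NormedSpace ℝ P]

theorem contDiffOn_affineSuperposition_integrand {Ψ : E × P → F →L[ℝ] G} {a : P → E} {s : P → ℝ} {U : Set E}
    (hΨ : ContDiff ℝ ∞ Ψ)
    (ha : ContDiff ℝ ∞ a) (hs : ContDiff ℝ ∞ s) {u : E → F} (hu : ContDiffOn ℝ ∞ u U) :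
    ContDiffOn ℝ ∞ (fun q : E × P => Ψ q (u (a q.2 + s q.2 • q.1)))
      ((fun q : E × P => a q.2 + s q.2 • q.1) ⁻¹' U) := by
  have h : ContDiff ℝ ∞ (fun q : E × P => a q.2 + s q.2 • q.1) := by fun_prop
  exact hΨ.contDiffOn.clm_apply (hu.comp h.contDiffOn fun q hq => hq)

variable [FiniteDimensional ℝ E] [CompleteSpace G] [MeasurableSpace P] [BorelSpace P]

/-- The operator `u ↦ ∫_{p ∈ K} Ψ(x, p) u(a(p) + s(p) x) dμ(p)`. -/
noncomputable def affineSuperposition (μ : Measure P) (Ψ : E × P → F →L[ℝ] G) (a : P → E)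
    (s : P → ℝ) (K : Set P) (u : E → F) (x : E) : G :=
  ∫ p in K, Ψ (x, p) (u (a p + s p • x)) ∂μ

variable {μ : Measure P} [IsFiniteMeasureOnCompacts μ] {Ψ : E × P → F →L[ℝ] G} {a : P → E}
  {s : P → ℝ} {K : Set P} {U V : Set E}

theorem contDiffOn_affineSuperposition (hΨ : ContDiff ℝ ∞ Ψ) (ha : ContDiff ℝ ∞ a)
    (hs : ContDiff ℝ ∞ s) (hK : IsCompact K) (hU : IsOpen U) (hV : IsOpen V)
    (hUV : ∀ x ∈ V, ∀ p ∈ K, a p + s p • x ∈ U) {u : E → F} (hu : ContDiffOn ℝ ∞ u U) :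
    ContDiffOn ℝ ∞ (affineSuperposition μ Ψ a s K u) V := by
  have hc : Continuous (fun q : E × P => a q.2 + s q.2 • q.1) := by
    have := ha.continuous; have := hs.continuous; fun_prop
  exact contDiffOn_setIntegral (hU.preimage hc)
    (contDiffOn_affineSuperposition_integrand hΨ ha hs hu) hV hK
    fun q hq => hUV q.1 hq.1 q.2 hq.2

/-- The Leibniz rule under the integral: derivatives of `Ψ` are bounded on `C ×ˢ K`, and each
derivative of `u (a p + s p • x)` costs a factor `s p`. The constant does not depend on `u`. -/
theorem exists_norm_iteratedFDeriv_affineSuperposition_le (hΨ : ContDiff ℝ ∞ Ψ)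
    (ha : ContDiff ℝ ∞ a) (hs : ContDiff ℝ ∞ s) (hK : IsCompact K) (hU : IsOpen U)
    (hV : IsOpen V) (hUV : ∀ x ∈ V, ∀ p ∈ K, a p + s p • x ∈ U) {C : Set E} (hC : IsCompact C)
    (hCV : C ⊆ V) (m : ℕ) :
    ∃ A, 0 ≤ A ∧ ∀ u : E → F, ContDiffOn ℝ ∞ u U → ∀ M,
      (∀ j ≤ m, ∀ x ∈ C, ∀ p ∈ K, ‖iteratedFDeriv ℝ j u (a p + s p • x)‖ ≤ M) →
      ∀ x ∈ C, ‖iteratedFDeriv ℝ m (affineSuperposition μ Ψ a s K u) x‖ ≤ A * M := by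
  have hc : Continuous (fun q : E × P => a q.2 + s q.2 • q.1) := by
    have := ha.continuous; have := hs.continuous; fun_prop
  have h1 (i : ℕ) : ∃ B, ∀ q ∈ C ×ˢ K,
      ‖iteratedFDeriv ℝ i (fun x => Ψ (x, q.2)) q.1‖ ≤ B :=
    (hC.prod hK).exists_bound_of_continuousOn
      ((continuousOn_iteratedFDeriv_left isOpen_univ hΨ.contDiffOn i).mono (Set.subset_univ _))
  choose B hB using h1
  obtain ⟨S, hS⟩ := hK.exists_bound_of_continuousOn hs.continuous.continuousOn
  set B' : ℝ := ∑ i ∈ Finset.range (m + 1), (m.choose i : ℝ) * |B i| * |S| ^ (m - i) with hB'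
  have hB'0 : 0 ≤ B' := Finset.sum_nonneg fun i _ => by positivity
  refine ⟨B' * μ.real K, by positivity, fun u hu M hM x hx => ?_⟩
  -- Without a point of `K` the hypothesis allows `M < 0`; then both sides are zero, as `μ.real ∅ =
  -- 0`.
  rcases K.eq_empty_or_nonempty with rfl | ⟨p₀, hp₀⟩
  · have h0 : affineSuperposition μ Ψ a s ∅ u = fun _ => 0 := by
      ext x; simp [affineSuperposition]
    simp only [h0, measureReal_empty, mul_zero, zero_mul]
    change ‖iteratedFDeriv ℝ m (0 : E → G) x‖ ≤ 0
    simp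
  have hM0 : 0 ≤ M := (norm_nonneg _).trans (hM 0 (Nat.zero_le _) x hx p₀ hp₀)
  have hx' := hCV hx
  have key : ∀ p ∈ K,
      ‖iteratedFDeriv ℝ m (fun x => Ψ (x, p) (u (a p + s p • x))) x‖ ≤ B' * M := by
    intro p hp
    set L : E →L[ℝ] E := s p • ContinuousLinearMap.id ℝ E with hL
    have hLn : ‖L‖ ≤ |S| := by
      calc ‖L‖ = ‖s p‖ * ‖ContinuousLinearMap.id ℝ E‖ := norm_smul _ _
        _ ≤ ‖s p‖ * 1 := by gcongr; exact ContinuousLinearMap.norm_id_le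
        _ ≤ |S| := by rw [mul_one]; exact (hS p hp).trans (le_abs_self S)
    have hLx (y : E) : a p + s p • y = L y + a p := by simp [hL, add_comm]
    set D : Set E := (fun y => a p + s p • y) ⁻¹' U with hD
    have hDo : IsOpen D := hU.preimage (by fun_prop)
    have hxD : x ∈ D := hUV x hx' p hp
    have h2 := ContinuousLinearMap.norm_iteratedFDerivWithin_le_of_bilinear
      (ContinuousLinearMap.id ℝ (F →L[ℝ] G)) (f := fun x => Ψ (x, p))
      (g := fun x => u (a p + s p • x)) (N := ∞) (s := D) (x := x) (n := m)
      (ContDiff.contDiffOn (hΨ.comp (by fun_prop)))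
      (hu.comp (ContDiff.contDiffOn (by fun_prop)) fun y hy => hy)
      hDo.uniqueDiffOn hxD (by exact_mod_cast le_top)
    simp only [iteratedFDerivWithin_of_isOpen _ hDo hxD, ContinuousLinearMap.id_apply] at h2
    refine h2.trans ?_
    calc _ ≤ 1 * ∑ i ∈ Finset.range (m + 1), (m.choose i : ℝ) * |B i| * (|S| ^ (m - i) * M) := by
          gcongr with i hi
          · exact ContinuousLinearMap.norm_id_le
          · exact (hB i (x, p) ⟨hx, hp⟩).trans (le_abs_self _)
          · simp only [hLx]
            rw [iteratedFDeriv_comp_affine hU hu L (a p) (by rw [← hLx]; exact hxD)]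
            refine (ContinuousMultilinearMap.norm_compContinuousLinearMap_le _ _).trans ?_
            rw [Finset.prod_const, Finset.card_univ, Fintype.card_fin, mul_comm]
            gcongr
            rw [← hLx]
            exact hM _ (Nat.sub_le _ _) x hx p hp
      _ = B' * M := by rw [one_mul, hB', Finset.sum_mul]; congr 1; ext i; ring
  change ‖iteratedFDeriv ℝ m (fun x => ∫ p in K, Ψ (x, p) (u (a p + s p • x)) ∂μ) x‖ ≤ _
  rw [iteratedFDeriv_setIntegral (hU.preimage hc)
    (contDiffOn_affineSuperposition_integrand hΨ ha hs hu) hV hK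
    (fun q hq => hUV q.1 hq.1 q.2 hq.2) m hx']
  refine (norm_setIntegral_le_of_norm_le_const hK.measure_lt_top key).trans (le_of_eq ?_)
  ring

end AffineSuperposition

/-! ### Changes of variables: homotheties about a point, and `s = t⁻¹`. -/

section Homothety

variable {E G : Type*} [NormedAddCommGroup E] [NormedSpace ℝ E] [FiniteDimensional ℝ E]
  [MeasurableSpace E] [BorelSpace E] {μ : Measure E} [μ.IsAddHaarMeasure]
  [NormedAddCommGroup G]

theorem integral_eq_abs_pow_smul_integral_homothety [NormedSpace ℝ G] (f : E → G) (x : E) {r : ℝ}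
    (hr : r ≠ 0) :
    ∫ y, f y ∂μ = |r| ^ Module.finrank ℝ E • ∫ z, f (x + r • (z - x)) ∂μ := by
  rw [integral_sub_right_eq_self (fun w => f (x + r • w)) x,
    Measure.integral_comp_smul μ (fun w => f (x + w)) r, integral_add_left_eq_self, smul_smul,
    abs_inv, abs_pow, mul_inv_cancel₀ (pow_ne_zero _ (abs_ne_zero.2 hr)), one_smul]

theorem integrable_comp_homothety_iff (f : E → G) (x : E) {r : ℝ} (hr : r ≠ 0) :
    Integrable (fun z => f (x + r • (z - x))) μ ↔ Integrable f μ := by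
  have h := integrable_comp_smul_iff μ (fun w => f (x + w)) hr
  refine Iff.trans ?_ (h.trans ((measurePreserving_add_left μ x).integrable_comp_emb (g := f)
    (MeasurableEquiv.addLeft x).measurableEmbedding))
  exact (measurePreserving_sub_right μ x).integrable_comp_emb (g := fun w => f (x + r • w))
    (MeasurableEquiv.subRight x).measurableEmbedding

end Homothety

theorem setIntegral_Ioi_one_inv {G : Type*} [NormedAddCommGroup G] [NormedSpace ℝ G]
    (φ : ℝ → G) :
    ∫ t in Set.Ioi (1 : ℝ), (t ^ 2)⁻¹ • φ t⁻¹ = ∫ s in Set.Icc (0 : ℝ) 1, φ s := by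
  have him : (fun t : ℝ => t⁻¹) '' Set.Ioi 1 = Set.Ioo 0 1 := by
    ext s
    constructor
    · rintro ⟨t, ht, rfl⟩
      have ht : 1 < t := ht
      exact ⟨by positivity, inv_lt_one_of_one_lt₀ ht⟩
    · rintro ⟨h0, h1⟩
      exact ⟨s⁻¹, (one_lt_inv₀ h0).2 h1, inv_inv s⟩
  rw [integral_Icc_eq_integral_Ioo, ← him,
    integral_image_eq_integral_abs_deriv_smul measurableSet_Ioi
      (f := fun t : ℝ => t⁻¹) (f' := fun t => -(t ^ 2)⁻¹)
      (fun t ht => (hasDerivAt_inv (ne_of_gt (zero_lt_one.trans ht))).hasDerivWithinAt)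
      inv_injective.injOn]
  refine setIntegral_congr_fun measurableSet_Ioi fun t ht => ?_
  simp only [abs_neg]
  rw [abs_of_nonneg (by positivity)]

/-! ### The integrands before and after the substitution. -/

section RayIntegrand

variable {E F G : Type*} [NormedAddCommGroup E] [NormedSpace ℝ E]
  [NormedAddCommGroup F] [NormedSpace ℝ F] [NormedAddCommGroup G] [NormedSpace ℝ G]
  {c : E →L[ℝ] F →L[ℝ] G} {θ : E → ℝ} {u : E → F} {k ℓ : ℕ} {ε : ℝ} {x : E}

/-- The integrand in the variables `(t, y)`; `ε = 1` and `ε = -1` select the ray from `x`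
through `y` and the opposite ray. -/
noncomputable def rayIntegrand (c : E →L[ℝ] F →L[ℝ] G) (θ : E → ℝ) (k ℓ : ℕ) (ε : ℝ) (u : E → F)
    (x : E) (q : ℝ × E) : G :=
  (q.1 ^ k * (q.1 - ε) ^ ℓ * θ (x + (ε * q.1) • (q.2 - x))) • c (x - q.2) (u q.2)

/-- The integrand in the variables `(s, z)`, where `s = t⁻¹` and `y = x + ε s (z - x)`. -/
noncomputable def segmentIntegrand (c : E →L[ℝ] F →L[ℝ] G) (θ : E → ℝ) (ℓ : ℕ) (ε : ℝ) (u : E → F)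
    (x : E) (q : ℝ × E) : G :=
  (ε * (1 - ε * q.1) ^ ℓ * θ q.2) • c (x - q.2) (u (x + (ε * q.1) • (q.2 - x)))

theorem continuous_rayIntegrand (hθ : Continuous θ) (hu : Continuous u) :
    Continuous (rayIntegrand c θ k ℓ ε u x) := by
  unfold rayIntegrand
  fun_prop

theorem continuous_segmentIntegrand (hθ : Continuous θ) (hu : Continuous u) :
    Continuous (segmentIntegrand c θ ℓ ε u x) := by
  unfold segmentIntegrand
  fun_prop

theorem segmentIntegrand_eq_zero {q : ℝ × E} (hq : q.2 ∉ tsupport θ) :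
    segmentIntegrand c θ ℓ ε u x q = 0 := by
  simp [segmentIntegrand, image_eq_zero_of_notMem_tsupport hq]

/-- The point where the singularity cancels: with `y - x = ε t⁻¹ (z - x)`, the powers add up to `t^k
(t - ε)^ℓ · t⁻ⁿ · ε t⁻¹ = ε (1 - ε t⁻¹)^ℓ t⁻²`, exactly because `n = k + ℓ + 1`. -/
theorem rayIntegrand_homothety (hd : Module.finrank ℝ E = k + ℓ + 1) (hε : ε * ε = 1) {t : ℝ}
    (ht : t ≠ 0) (z : E) :
    (t ^ Module.finrank ℝ E)⁻¹ • rayIntegrand c θ k ℓ ε u x (t, x + (ε * t⁻¹) • (z - x)) =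
      (t ^ 2)⁻¹ • segmentIntegrand c θ ℓ ε u x (t⁻¹, z) := by
  have h1 : x + (ε * t) • (x + (ε * t⁻¹) • (z - x) - x) = z := by
    rw [add_sub_cancel_left, smul_smul,
      show ε * t * (ε * t⁻¹) = (ε * ε) * (t * t⁻¹) by ring, hε, mul_inv_cancel₀ ht]
    simp
  have h2 : x - (x + (ε * t⁻¹) • (z - x)) = (ε * t⁻¹) • (x - z) := by
    rw [← neg_sub z x, smul_neg]; abel
  simp only [rayIntegrand, segmentIntegrand, h1, h2, map_smul, smul_apply,
    smul_smul, hd]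
  congr 1
  have h3 : 1 - ε * t⁻¹ = (t - ε) * t⁻¹ := by field_simp
  rw [h3, mul_pow, inv_pow]
  field_simp
  ring

/-- The integrand of the Bogovskii-type operator in the variables `(t, y)`. -/
noncomputable def backwardIntegrand (c : E →L[ℝ] F →L[ℝ] G) (θ : E → ℝ) (k ℓ : ℕ) (u : E → F)
    (x : E) (q : ℝ × E) : G :=
  ((q.1 - 1) ^ k * q.1 ^ ℓ * θ (q.2 + q.1 • (x - q.2))) • c (x - q.2) (u q.2)

theorem continuous_backwardIntegrand (hθ : Continuous θ) (hu : Continuous u) :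
    Continuous (backwardIntegrand c θ k ℓ u x) := by
  unfold backwardIntegrand
  fun_prop

/-- The shift moves the base point of the ray from `y` to `x`, since `y + (t + 1)(x - y) = x - t (y
- x)`; the range `t > 2` becomes `t > 1`. -/
theorem backwardIntegrand_add_one (t : ℝ) (y : E) :
    backwardIntegrand c θ k ℓ u x (t + 1, y) = rayIntegrand c θ k ℓ (-1) u x (t, y) := by
  have h : y + (t + 1) • (x - y) = x + (-1 * t) • (y - x) := by module
  simp only [backwardIntegrand, rayIntegrand, h, add_sub_cancel_right, sub_neg_eq_add]

theorem backwardIntegrand_eq_zero {K : Set E} (huK : ∀ y, y ∉ K → u y = 0) {q : ℝ × E}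
    (hq : q.2 ∉ K) : backwardIntegrand c θ k ℓ u x q = 0 := by
  simp [backwardIntegrand, huK _ hq]

end RayIntegrand

/-! ### Cutting the `t`-integral at `2`. -/

section ProductMeasure

variable {E : Type*} [MeasurableSpace E] {μ : Measure E} [SFinite μ]

theorem measurePreserving_add_one_prod :
    MeasurePreserving (fun q : ℝ × E => (q.1 + 1, q.2))
      ((volume.restrict (Set.Ioi 1)).prod μ) ((volume.restrict (Set.Ioi 2)).prod μ) := by
  have h := (measurePreserving_add_right (volume : Measure ℝ) 1).restrict_preimage
    (measurableSet_Ioi (a := 2))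
  have h2 : (fun t : ℝ => t + 1) ⁻¹' Set.Ioi 2 = Set.Ioi 1 := by
    rw [Set.preimage_add_const_Ioi]; norm_num
  rw [h2] at h
  exact h.prod (MeasurePreserving.id μ)

theorem restrict_Icc_one_two_prod :
    (volume.restrict (Set.Ioc (1 : ℝ) 2)).prod μ =
      (volume.prod μ).restrict (Set.Icc (1 : ℝ) 2 ×ˢ Set.univ) := by
  rw [Measure.restrict_congr_set Ioc_ae_eq_Icc, ← Measure.prod_restrict, Measure.restrict_univ]

theorem restrict_Ioi_one_prod :
    (volume.restrict (Set.Ioi (1 : ℝ))).prod μ =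
      (volume.restrict (Set.Ioc (1 : ℝ) 2)).prod μ + (volume.restrict (Set.Ioi 2)).prod μ := by
  rw [← Measure.add_prod, ← Measure.restrict_union Set.Ioc_disjoint_Ioi_same measurableSet_Ioi,
    Set.Ioc_union_Ioi_eq_Ioi one_le_two]

end ProductMeasure

/-! ### Absolute convergence and regular form of the double integrals. -/

section RayIntegral

variable {E F G : Type*} [NormedAddCommGroup E] [NormedSpace ℝ E] [FiniteDimensional ℝ E]
  [MeasurableSpace E] [BorelSpace E] {μ : Measure E} [μ.IsAddHaarMeasure]
  [NormedAddCommGroup F] [NormedSpace ℝ F] [NormedAddCommGroup G] [NormedSpace ℝ G]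
  {c : E →L[ℝ] F →L[ℝ] G} {θ : E → ℝ} {u : E → F} {k ℓ : ℕ} {ε : ℝ} {x : E}

theorem integrable_rayIntegrand_right (hd : Module.finrank ℝ E = k + ℓ + 1) (hε : ε * ε = 1)
    (hθ : Continuous θ) (hθc : HasCompactSupport θ) (hu : Continuous u) {t : ℝ} (ht : t ≠ 0) :
    Integrable (fun y => rayIntegrand c θ k ℓ ε u x (t, y)) μ := by
  have hε0 : ε ≠ 0 := fun h => by simp [h] at hε
  rw [← integrable_comp_homothety_iff _ x (mul_ne_zero hε0 (inv_ne_zero ht)),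
    ← integrable_fun_smul_iff (c := (t ^ Module.finrank ℝ E)⁻¹) (inv_ne_zero (pow_ne_zero _ ht))]
  simp_rw [rayIntegrand_homothety hd hε ht]
  refine Continuous.integrable_of_hasCompactSupport ?_ ?_
  · have := continuous_segmentIntegrand (c := c) (ℓ := ℓ) (ε := ε) (x := x) hθ hu
    fun_prop
  · exact HasCompactSupport.intro hθc fun z hz => by
      rw [segmentIntegrand_eq_zero (q := (t⁻¹, z)) hz, smul_zero]

theorem integral_norm_rayIntegrand (hd : Module.finrank ℝ E = k + ℓ + 1) (hε : ε * ε = 1) {t : ℝ}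
    (ht : 0 < t) :
    ∫ y, ‖rayIntegrand c θ k ℓ ε u x (t, y)‖ ∂μ =
      (t ^ 2)⁻¹ * ∫ z, ‖segmentIntegrand c θ ℓ ε u x (t⁻¹, z)‖ ∂μ := by
  have hε0 : ε ≠ 0 := fun h => by simp [h] at hε
  have hεa : |ε| = 1 := by
    rcases mul_self_eq_one_iff.1 hε with rfl | rfl <;> simp
  rw [integral_eq_abs_pow_smul_integral_homothety _ x (mul_ne_zero hε0 (inv_ne_zero ht.ne')),
    abs_mul, hεa, one_mul, abs_of_pos (inv_pos.2 ht), inv_pow, smul_eq_mul,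
    ← integral_const_mul, ← integral_const_mul]
  congr 1 with z
  have h := congrArg norm (rayIntegrand_homothety (c := c) (θ := θ) (u := u) (x := x) hd hε
    ht.ne' z)
  rwa [norm_smul, norm_smul, Real.norm_of_nonneg (by positivity),
    Real.norm_of_nonneg (by positivity)] at h

theorem integral_rayIntegrand_right (hd : Module.finrank ℝ E = k + ℓ + 1) (hε : ε * ε = 1) {t : ℝ}
    (ht : 0 < t) :
    ∫ y, rayIntegrand c θ k ℓ ε u x (t, y) ∂μ =
      (t ^ 2)⁻¹ • ∫ z, segmentIntegrand c θ ℓ ε u x (t⁻¹, z) ∂μ := by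
  have hε0 : ε ≠ 0 := fun h => by simp [h] at hε
  have hεa : |ε| = 1 := by
    rcases mul_self_eq_one_iff.1 hε with rfl | rfl <;> simp
  rw [integral_eq_abs_pow_smul_integral_homothety _ x (mul_ne_zero hε0 (inv_ne_zero ht.ne')),
    abs_mul, hεa, one_mul, abs_of_pos (inv_pos.2 ht), inv_pow, ← integral_smul, ← integral_smul]
  congr 1 with z
  exact rayIntegrand_homothety hd hε ht.ne' z

/-- After the homothety the `y`-integral of the norm is at most a constant times `t⁻²`, because the
regular integrand is bounded on `[0,1] × supp θ`. -/
theorem integrable_rayIntegrand (hd : Module.finrank ℝ E = k + ℓ + 1) (hε : ε * ε = 1)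
    (hθ : Continuous θ) (hθc : HasCompactSupport θ) (hu : Continuous u) :
    Integrable (rayIntegrand c θ k ℓ ε u x) ((volume.restrict (Set.Ioi 1)).prod μ) := by
  have hmeas : AEStronglyMeasurable (rayIntegrand c θ k ℓ ε u x)
      ((volume.restrict (Set.Ioi 1)).prod μ) :=
    (continuous_rayIntegrand hθ hu).aestronglyMeasurable
  obtain ⟨B, hB⟩ := ((isCompact_Icc (a := (0 : ℝ)) (b := 1)).prod
    hθc.isCompact).exists_bound_of_continuousOn
    (continuous_segmentIntegrand (c := c) (ℓ := ℓ) (ε := ε) (x := x) hθ hu).continuousOn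
  refine (integrable_prod_iff hmeas).2 ⟨?_, ?_⟩
  · filter_upwards [ae_restrict_mem measurableSet_Ioi] with t ht
    exact integrable_rayIntegrand_right hd hε hθ hθc hu (zero_lt_one.trans ht).ne'
  · have hi : IntegrableOn (fun t : ℝ => t ^ (-2 : ℝ) * (|B| * μ.real (tsupport θ)))
        (Set.Ioi 1) :=
      (integrableOn_Ioi_rpow_of_lt (by norm_num) zero_lt_one).mul_const _
    refine hi.mono' hmeas.norm.integral_prod_right' ?_
    filter_upwards [ae_restrict_mem measurableSet_Ioi] with t ht
    have ht1 : 1 < t := ht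
    have ht0 : 0 < t := zero_lt_one.trans ht1
    rw [integral_norm_rayIntegrand hd hε ht0, norm_mul, Real.norm_of_nonneg (by positivity),
      Real.rpow_neg ht0.le, Real.rpow_two]
    gcongr
    rw [← setIntegral_eq_integral_of_forall_compl_eq_zero (s := tsupport θ) fun z hz => by
      rw [segmentIntegrand_eq_zero (q := (t⁻¹, z)) hz, norm_zero]]
    refine norm_setIntegral_le_of_norm_le_const hθc.isCompact.measure_lt_top fun z hz => ?_
    rw [norm_norm]
    exact (hB (t⁻¹, z) ⟨⟨by positivity, (inv_lt_one_of_one_lt₀ ht1).le⟩, hz⟩).trans (le_abs_self B)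

theorem integral_rayIntegrand (hd : Module.finrank ℝ E = k + ℓ + 1) (hε : ε * ε = 1)
    (hθ : Continuous θ) (hθc : HasCompactSupport θ) (hu : Continuous u) :
    ∫ q, rayIntegrand c θ k ℓ ε u x q ∂((volume.restrict (Set.Ioi 1)).prod μ) =
      ∫ q in Set.Icc (0 : ℝ) 1 ×ˢ tsupport θ, segmentIntegrand c θ ℓ ε u x q ∂volume.prod μ := by
  rw [integral_prod _ (integrable_rayIntegrand hd hε hθ hθc hu),
    setIntegral_congr_fun measurableSet_Ioi fun t ht =>
      integral_rayIntegrand_right hd hε (zero_lt_one.trans ht),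
    setIntegral_Ioi_one_inv (fun s => ∫ z, segmentIntegrand c θ ℓ ε u x (s, z) ∂μ),
    setIntegral_prod _ ((continuous_segmentIntegrand hθ hu).continuousOn.integrableOn_compact
      (isCompact_Icc.prod hθc.isCompact))]
  refine setIntegral_congr_fun measurableSet_Icc fun s _ => ?_
  exact (setIntegral_eq_integral_of_forall_compl_eq_zero fun z hz =>
    segmentIntegrand_eq_zero (q := (s, z)) hz).symm

theorem measurableEmbedding_add_one_prod :
    MeasurableEmbedding (fun q : ℝ × E => (q.1 + 1, q.2)) :=
  ((Homeomorph.addRight (1 : ℝ)).prodCongr (Homeomorph.refl E)).measurableEmbedding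

theorem integrable_backwardIntegrand_far (hd : Module.finrank ℝ E = k + ℓ + 1)
    (hθ : Continuous θ) (hθc : HasCompactSupport θ) (hu : Continuous u) :
    Integrable (backwardIntegrand c θ k ℓ u x) ((volume.restrict (Set.Ioi 2)).prod μ) := by
  rw [← measurePreserving_add_one_prod.integrable_comp_emb measurableEmbedding_add_one_prod]
  refine (integrable_rayIntegrand (c := c) (x := x) (ε := -1) hd (by norm_num) hθ hθc hu).congr
    (Filter.Eventually.of_forall fun q => ?_)
  exact (backwardIntegrand_add_one q.1 q.2).symm

theorem integral_backwardIntegrand_far (hd : Module.finrank ℝ E = k + ℓ + 1)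
    (hθ : Continuous θ) (hθc : HasCompactSupport θ) (hu : Continuous u) :
    ∫ q, backwardIntegrand c θ k ℓ u x q ∂((volume.restrict (Set.Ioi 2)).prod μ) =
      ∫ q in Set.Icc (0 : ℝ) 1 ×ˢ tsupport θ,
        segmentIntegrand c θ ℓ (-1) u x q ∂volume.prod μ := by
  rw [← integral_rayIntegrand hd (by norm_num) hθ hθc hu,
    ← measurePreserving_add_one_prod.integral_comp measurableEmbedding_add_one_prod]
  exact integral_congr_ae (Filter.Eventually.of_forall fun q => backwardIntegrand_add_one q.1 q.2)

theorem integrable_backwardIntegrand_near (hθ : Continuous θ) (hu : Continuous u) {K : Set E}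
    (hK : IsCompact K) (huK : ∀ y, y ∉ K → u y = 0) :
    Integrable (backwardIntegrand c θ k ℓ u x) ((volume.restrict (Set.Ioc 1 2)).prod μ) := by
  rw [restrict_Icc_one_two_prod]
  refine IntegrableOn.of_forall_sdiff_eq_zero (s := Set.Icc (1 : ℝ) 2 ×ˢ K)
    ((continuous_backwardIntegrand hθ hu).continuousOn.integrableOn_compact
      (isCompact_Icc.prod hK)) (measurableSet_Icc.prod MeasurableSet.univ) fun q hq => ?_
  exact backwardIntegrand_eq_zero huK fun h => hq.2 ⟨hq.1.1, h⟩

theorem integrable_backwardIntegrand (hd : Module.finrank ℝ E = k + ℓ + 1)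
    (hθ : Continuous θ) (hθc : HasCompactSupport θ) (hu : Continuous u) {K : Set E}
    (hK : IsCompact K) (huK : ∀ y, y ∉ K → u y = 0) :
    Integrable (backwardIntegrand c θ k ℓ u x) ((volume.restrict (Set.Ioi 1)).prod μ) := by
  rw [restrict_Ioi_one_prod]
  exact (integrable_backwardIntegrand_near hθ hu hK huK).add_measure
    (integrable_backwardIntegrand_far hd hθ hθc hu)

theorem integral_backwardIntegrand (hd : Module.finrank ℝ E = k + ℓ + 1)
    (hθ : Continuous θ) (hθc : HasCompactSupport θ) (hu : Continuous u) {K : Set E}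
    (hK : IsCompact K) (huK : ∀ y, y ∉ K → u y = 0) :
    ∫ q, backwardIntegrand c θ k ℓ u x q ∂((volume.restrict (Set.Ioi 1)).prod μ) =
      (∫ q in Set.Icc (1 : ℝ) 2 ×ˢ K, backwardIntegrand c θ k ℓ u x q ∂volume.prod μ) +
      ∫ q in Set.Icc (0 : ℝ) 1 ×ˢ tsupport θ,
        segmentIntegrand c θ ℓ (-1) u x q ∂volume.prod μ := by
  rw [restrict_Ioi_one_prod, integral_add_measure (integrable_backwardIntegrand_near hθ hu hK huK)
    (integrable_backwardIntegrand_far hd hθ hθc hu), integral_backwardIntegrand_far hd hθ hθc hu,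
    restrict_Icc_one_two_prod]
  congr 1
  refine setIntegral_eq_of_subset_of_forall_sdiff_eq_zero
    (measurableSet_Icc.prod MeasurableSet.univ) (Set.prod_mono le_rfl (Set.subset_univ _))
    fun q hq => ?_
  exact backwardIntegrand_eq_zero huK fun h => hq.2 ⟨hq.1.1, h⟩

end RayIntegral

/-! ### The regular integrals as affine superpositions. -/

section RayKernel

variable {E F G : Type*} [NormedAddCommGroup E] [NormedSpace ℝ E]
  [NormedAddCommGroup F] [NormedSpace ℝ F] [NormedAddCommGroup G] [NormedSpace ℝ G]
  {c : E →L[ℝ] F →L[ℝ] G} {θ : E → ℝ} {u : E → F} {k ℓ : ℕ} {ε : ℝ} {x : E}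

/-- The operator-valued kernel of `segmentIntegrand`. -/
noncomputable def segmentKernel (c : E →L[ℝ] F →L[ℝ] G) (θ : E → ℝ) (ℓ : ℕ) (ε : ℝ)
    (q : E × ℝ × E) : F →L[ℝ] G :=
  (ε * (1 - ε * q.2.1) ^ ℓ * θ q.2.2) • c (q.1 - q.2.2)

/-- The operator-valued kernel of `backwardIntegrand`. -/
noncomputable def backwardKernel (c : E →L[ℝ] F →L[ℝ] G) (θ : E → ℝ) (k ℓ : ℕ)
    (q : E × ℝ × E) : F →L[ℝ] G :=
  ((q.2.1 - 1) ^ k * q.2.1 ^ ℓ * θ (q.2.2 + q.2.1 • (q.1 - q.2.2))) • c (q.1 - q.2.2)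

theorem contDiff_segmentKernel (hθ : ContDiff ℝ ∞ θ) : ContDiff ℝ ∞ (segmentKernel c θ ℓ ε) := by
  unfold segmentKernel
  fun_prop

theorem contDiff_backwardKernel (hθ : ContDiff ℝ ∞ θ) :
    ContDiff ℝ ∞ (backwardKernel c θ k ℓ) := by
  unfold backwardKernel
  fun_prop

theorem setIntegral_segmentIntegrand_eq [MeasurableSpace E] (μ : Measure (ℝ × E))
    (A : Set (ℝ × E)) :
    (∫ q in A, segmentIntegrand c θ ℓ ε u x q ∂μ) =
      affineSuperposition μ (segmentKernel c θ ℓ ε) (fun p => (ε * p.1) • p.2)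
        (fun p => 1 - ε * p.1) A u x := by
  unfold affineSuperposition
  congr 1 with q : 1
  have h : x + (ε * q.1) • (q.2 - x) = (ε * q.1) • q.2 + (1 - ε * q.1) • x := by module
  simp [segmentIntegrand, segmentKernel, h]

/-- With scaling `0`, the argument of `u` does not involve `x`: all `x`-derivatives fall on the
kernel. -/
theorem setIntegral_backwardIntegrand_eq [MeasurableSpace E] (μ : Measure (ℝ × E))
    (A : Set (ℝ × E)) :
    (∫ q in A, backwardIntegrand c θ k ℓ u x q ∂μ) =
      affineSuperposition μ (backwardKernel c θ k ℓ) (fun p => p.2) (fun _ => 0) A u x := by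
  unfold affineSuperposition
  congr 1 with q : 1
  simp [backwardIntegrand, backwardKernel]

end RayKernel

/-! ### Regular formulas for the two operators, and locality of their kernels. -/

section OperatorFormulas

variable {n k ℓ : ℕ} {θ : EuclideanSpace ℝ (Fin n) → ℝ}
  {u v : EuclideanSpace ℝ (Fin n) → AltForm n (ℓ + 1)} {x y : EuclideanSpace ℝ (Fin n)}

/-- The contraction of a form with a vector, as a continuous bilinear map. -/
noncomputable def contraction (n ℓ : ℕ) :
    EuclideanSpace ℝ (Fin n) →L[ℝ] AltForm n (ℓ + 1) →L[ℝ] AltForm n ℓ :=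
  (ContinuousAlternatingMap.curryLeftLI (𝕜 := ℝ) (E := EuclideanSpace ℝ (Fin n)) (F := ℝ)
    (n := ℓ)).toContinuousLinearMap.flip

/-- Some `t > 1` has `z = y + t (x - y)` in the support of `θ`; solve for `x` with `s = t⁻¹`. -/
theorem exists_of_kernelG_ne_zero {m : ℤ} (h : kernelG θ m x y ≠ 0) :
    ∃ z ∈ tsupport θ, ∃ s ∈ Set.Icc (0 : ℝ) 1, x = y + s • (z - y) := by
  by_contra! hne
  refine h (setIntegral_eq_zero_of_forall_eq_zero fun t ht => ?_)
  have ht1 : 1 < t := ht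
  have ht0 : t ≠ 0 := (zero_lt_one.trans ht1).ne'
  rw [image_eq_zero_of_notMem_tsupport (f := θ) fun hz => hne _ hz t⁻¹
    ⟨by positivity, (inv_lt_one_of_one_lt₀ ht1).le⟩ ?_, mul_zero]
  rw [add_sub_cancel_left, inv_smul_smul₀ ht0, add_sub_cancel]

theorem poincareIntegrand_add :
    poincareIntegrand θ (u + v) x = poincareIntegrand θ u x + poincareIntegrand θ v x := by
  ext1 y
  simp [poincareIntegrand]

theorem poincareIntegrand_smul (c : ℝ) :
    poincareIntegrand θ (c • u) x = c • poincareIntegrand θ u x := by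
  ext1 y
  simp [poincareIntegrand, smul_comm c]

theorem bogovskiiIntegrand_add :
    bogovskiiIntegrand θ (u + v) x = bogovskiiIntegrand θ u x + bogovskiiIntegrand θ v x := by
  ext1 y
  simp [bogovskiiIntegrand]

theorem bogovskiiIntegrand_smul (c : ℝ) :
    bogovskiiIntegrand θ (c • u) x = c • bogovskiiIntegrand θ u x := by
  ext1 y
  simp [bogovskiiIntegrand, smul_comm c]

/-- Only values of `u` on segments from `x` to the support of `θ` matter. Hence a form given on `Ω`
may be extended by zero, and the operator commutes with restriction. -/
theorem poincareIntegrand_congr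
    (h : ∀ z ∈ tsupport θ, ∀ s ∈ Set.Icc (0 : ℝ) 1, u (x + s • (z - x)) = v (x + s • (z - x))) :
    poincareIntegrand θ u x = poincareIntegrand θ v x := by
  ext1 y
  unfold poincareIntegrand
  by_cases h0 : kernelG θ ((n : ℤ) - ((ℓ + 1 : ℕ) : ℤ) + 1) y x = 0
  · rw [h0, zero_smul, zero_smul]
  · obtain ⟨z, hz, s, hs, rfl⟩ := exists_of_kernelG_ne_zero h0
    rw [h z hz s hs]

theorem bogovskiiIntegrand_eq_zero {K K' : Set (EuclideanSpace ℝ (Fin n))}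
    (huK : ∀ y, y ∉ K → u y = 0)
    (hKK' : ∀ y ∈ K, ∀ z ∈ tsupport θ, ∀ s ∈ Set.Icc (0 : ℝ) 1, y + s • (z - y) ∈ K')
    (hx : x ∉ K') : bogovskiiIntegrand θ u x = 0 := by
  ext1 y
  unfold bogovskiiIntegrand
  by_cases hy : y ∈ K
  · by_cases h0 : kernelG θ ((ℓ + 1 : ℕ) : ℤ) x y = 0
    · rw [h0, zero_smul, Pi.zero_apply]
    · obtain ⟨z, hz, s, hs, rfl⟩ := exists_of_kernelG_ne_zero h0
      exact absurd (hKK' y hy z hz s hs) hx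
  · rw [huK y hy]
    simp

theorem poincareIntegrand_eq (hn : n = k + ℓ + 1) :
    poincareIntegrand θ u x =
      fun y => ∫ t in Set.Ioi (1 : ℝ), rayIntegrand (contraction n ℓ) θ k ℓ 1 u x (t, y) := by
  ext1 y
  simp only [poincareIntegrand, kernelG, rayIntegrand]
  rw [integral_smul_const]
  congr 1
  have h1 : (n : ℤ) - ((n : ℤ) - ((ℓ + 1 : ℕ) : ℤ) + 1) = (ℓ : ℕ) := by push_cast; ring
  have h2 : (n : ℤ) - ((ℓ + 1 : ℕ) : ℤ) + 1 - 1 = (k : ℕ) := by rw [hn]; push_cast; ring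
  simp only [h1, h2, zpow_natCast, one_mul]
  congr 1 with t
  ring

theorem bogovskiiIntegrand_eq (hn : n = k + ℓ + 1) :
    bogovskiiIntegrand θ u x =
      fun y => ∫ t in Set.Ioi (1 : ℝ),
        backwardIntegrand (contraction n ℓ) θ k ℓ u x (t, y) := by
  ext1 y
  simp only [bogovskiiIntegrand, kernelG, backwardIntegrand]
  rw [integral_smul_const]
  congr 1
  have h1 : (n : ℤ) - ((ℓ + 1 : ℕ) : ℤ) = (k : ℕ) := by rw [hn]; push_cast; ring
  have h2 : ((ℓ + 1 : ℕ) : ℤ) - 1 = (ℓ : ℕ) := by push_cast; ring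
  simp only [h1, h2, zpow_natCast]

theorem finrank_euclideanSpace_eq (hn : n = k + ℓ + 1) :
    Module.finrank ℝ (EuclideanSpace ℝ (Fin n)) = k + ℓ + 1 := by
  rw [finrank_euclideanSpace_fin, hn]

theorem integrable_poincareIntegrand (hn : n = k + ℓ + 1) (hθ : Continuous θ)
    (hθc : HasCompactSupport θ) (hu : Continuous u) : Integrable (poincareIntegrand θ u x) := by
  rw [poincareIntegrand_eq hn]
  exact (integrable_rayIntegrand (finrank_euclideanSpace_eq hn) (one_mul 1) hθ hθc
    hu).integral_prod_right

theorem poincareOp_eq (hn : n = k + ℓ + 1) (hθ : Continuous θ)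
    (hθc : HasCompactSupport θ) (hu : Continuous u) :
    poincareOp θ u x = ∫ q in Set.Icc (0 : ℝ) 1 ×ˢ tsupport θ,
      segmentIntegrand (contraction n ℓ) θ ℓ 1 u x q := by
  rw [poincareOp, poincareIntegrand_eq hn, ← integral_prod_symm _
    (integrable_rayIntegrand (finrank_euclideanSpace_eq hn) (one_mul 1) hθ hθc hu),
    integral_rayIntegrand (finrank_euclideanSpace_eq hn) (one_mul 1) hθ hθc hu]
  rfl

theorem integrable_bogovskiiIntegrand (hn : n = k + ℓ + 1) (hθ : Continuous θ)
    (hθc : HasCompactSupport θ) (hu : Continuous u) {K : Set (EuclideanSpace ℝ (Fin n))}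
    (hK : IsCompact K) (huK : ∀ y, y ∉ K → u y = 0) :
    Integrable (bogovskiiIntegrand θ u x) := by
  rw [bogovskiiIntegrand_eq hn]
  exact (integrable_backwardIntegrand (finrank_euclideanSpace_eq hn) hθ hθc
    hu hK huK).integral_prod_right

theorem bogovskiiOp_eq (hn : n = k + ℓ + 1) (hθ : Continuous θ)
    (hθc : HasCompactSupport θ) (hu : Continuous u) {K : Set (EuclideanSpace ℝ (Fin n))}
    (hK : IsCompact K) (huK : ∀ y, y ∉ K → u y = 0) :
    bogovskiiOp θ u x =
      (∫ q in Set.Icc (1 : ℝ) 2 ×ˢ K, backwardIntegrand (contraction n ℓ) θ k ℓ u x q) +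
      ∫ q in Set.Icc (0 : ℝ) 1 ×ˢ tsupport θ,
        segmentIntegrand (contraction n ℓ) θ ℓ (-1) u x q := by
  rw [bogovskiiOp, bogovskiiIntegrand_eq hn, ← integral_prod_symm _
    (integrable_backwardIntegrand (finrank_euclideanSpace_eq hn) hθ hθc hu hK huK),
    integral_backwardIntegrand (finrank_euclideanSpace_eq hn) hθ hθc hu hK huK]
  rfl

theorem exists_continuous_eqOn_of_isCompact {E F : Type*} [TopologicalSpace E] [T2Space E]
    [LocallyCompactSpace E] [NormedAddCommGroup F] [NormedSpace ℝ F] {Ω K : Set E} (hΩ : IsOpen Ω)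
    (hK : IsCompact K) (hKΩ : K ⊆ Ω) {u : E → F} (hu : ContinuousOn u Ω) :
    ∃ v : E → F, Continuous v ∧ Set.EqOn v u K := by
  obtain ⟨L, hL, hKL, hLΩ⟩ := exists_compact_between hK hΩ hKΩ
  obtain ⟨f, hf1, hf0, -⟩ := exists_continuous_one_zero_of_isCompact hK
    isOpen_interior.isClosed_compl
    (Set.disjoint_compl_right_iff_subset.2 hKL)
  have hsupp : tsupport (fun x => f x • u x) ⊆ L := by
    refine closure_minimal (fun x hx => ?_) hL.isClosed
    by_contra hxL
    refine hx ?_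
    simp [hf0 (show x ∈ (interior L)ᶜ from fun h => hxL (interior_subset h))]
  refine ⟨fun x => f x • u x, ?_, fun x hx => by simp [hf1 hx]⟩
  exact ContinuousOn.continuous_of_tsupport_subset (f.continuous.continuousOn.smul hu) hΩ
    (hsupp.trans hLΩ)

theorem isCompact_image_segment {E : Type*} [NormedAddCommGroup E] [NormedSpace ℝ E]
    {K L : Set E} (hK : IsCompact K) (hL : IsCompact L) :
    IsCompact ((fun q : E × E × ℝ => q.1 + q.2.2 • (q.2.1 - q.1)) ''
      (K ×ˢ L ×ˢ Set.Icc (0 : ℝ) 1)) :=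
  (hK.prod (hL.prod isCompact_Icc)).image (by fun_prop)

/-- The extension of `u` by zero need not be continuous. For fixed `x` the relevant segments form a
compact subset of `Ω`, so `u` can be replaced by a cut-off form, to which the global formulas apply.
-/
theorem exists_continuous_poincareIntegrand_eq {Ω : Set (EuclideanSpace ℝ (Fin n))} (hΩ : IsOpen Ω)
    (hΩθ : ∀ x ∈ Ω, ∀ z ∈ tsupport θ, ∀ s ∈ Set.Icc (0 : ℝ) 1, x + s • (z - x) ∈ Ω)
    (hθc : HasCompactSupport θ)
    (hu : ContinuousOn u Ω) (hx : x ∈ Ω) :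
    ∃ v, Continuous v ∧ poincareIntegrand θ u x = poincareIntegrand θ v x ∧
      ∀ q ∈ Set.Icc (0 : ℝ) 1 ×ˢ tsupport θ, u (x + q.1 • (q.2 - x)) = v (x + q.1 • (q.2 - x)) := by
  obtain ⟨v, hv, hvu⟩ := exists_continuous_eqOn_of_isCompact hΩ
    (isCompact_image_segment (isCompact_singleton (x := x)) hθc.isCompact)
    (by rintro _ ⟨⟨y, z, s⟩, ⟨rfl, hz, hs⟩, rfl⟩; exact hΩθ _ hx z hz s hs) hu
  have h (z) (hz : z ∈ tsupport θ) (s) (hs : s ∈ Set.Icc (0 : ℝ) 1) :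
      u (x + s • (z - x)) = v (x + s • (z - x)) :=
    (hvu ⟨(x, z, s), ⟨rfl, hz, hs⟩, rfl⟩).symm
  exact ⟨v, hv, poincareIntegrand_congr h, fun q hq => h q.2 hq.2 q.1 hq.1⟩

theorem integrable_poincareIntegrand_of_continuousOn {Ω : Set (EuclideanSpace ℝ (Fin n))} (hΩ : IsOpen Ω)
    (hΩθ : ∀ x ∈ Ω, ∀ z ∈ tsupport θ, ∀ s ∈ Set.Icc (0 : ℝ) 1, x + s • (z - x) ∈ Ω)
    (hn : n = k + ℓ + 1) (hθ : Continuous θ)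
    (hθc : HasCompactSupport θ) (hu : ContinuousOn u Ω) (hx : x ∈ Ω) :
    Integrable (poincareIntegrand θ u x) := by
  obtain ⟨v, hv, h, -⟩ := exists_continuous_poincareIntegrand_eq hΩ hΩθ hθc hu hx
  rw [h]
  exact integrable_poincareIntegrand hn hθ hθc hv

theorem poincareOp_eq_of_continuousOn {Ω : Set (EuclideanSpace ℝ (Fin n))} (hΩ : IsOpen Ω)
    (hΩθ : ∀ x ∈ Ω, ∀ z ∈ tsupport θ, ∀ s ∈ Set.Icc (0 : ℝ) 1, x + s • (z - x) ∈ Ω)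
    (hn : n = k + ℓ + 1) (hθ : Continuous θ)
    (hθc : HasCompactSupport θ) (hu : ContinuousOn u Ω) (hx : x ∈ Ω) :
    poincareOp θ u x = ∫ q in Set.Icc (0 : ℝ) 1 ×ˢ tsupport θ,
      segmentIntegrand (contraction n ℓ) θ ℓ 1 u x q := by
  obtain ⟨v, hv, h, huv⟩ := exists_continuous_poincareIntegrand_eq hΩ hΩθ hθc hu hx
  rw [poincareOp, h]
  refine (poincareOp_eq hn hθ hθc hv).trans
    (setIntegral_congr_fun (measurableSet_Icc.prod hθc.isCompact.measurableSet) fun q hq => ?_)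
  simp only [segmentIntegrand, one_mul, huv q hq]

end OperatorFormulas

/-! ### A continuity criterion for linear maps between spaces of smooth functions. -/

section SmoothOnTopology

variable {E F G : Type*} [NormedAddCommGroup E] [NormedSpace ℝ E]
  [NormedAddCommGroup F] [NormedSpace ℝ F] [NormedAddCommGroup G] [NormedSpace ℝ G]
  {U V : Opens E}

theorem SmoothOn.iterDeriv_sub (m : ℕ) (u v : SmoothOn U F) {x : E} (hx : x ∈ U) :
    iteratedFDeriv ℝ m (u - v : SmoothOn U F) x =
      iteratedFDeriv ℝ m u x - iteratedFDeriv ℝ m v x := by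
  have h (w : SmoothOn U F) : ContDiffAt ℝ m w x :=
    (w.contDiffOn.contDiffAt (U.isOpen.mem_nhds hx)).of_le (by exact_mod_cast le_top)
  exact iteratedFDeriv_sub_apply (h u) (h v)

theorem SmoothOn.continuous_iterDeriv (m : ℕ) :
    Continuous (SmoothOn.iterDeriv (U := U) (F := F) m) :=
  continuous_iInf_dom (i := m) continuous_induced_dom

theorem SmoothOn.eventually_dist_iteratedFDeriv_lt (u : SmoothOn U F) {C : Set E}
    (hC : IsCompact C) (hCU : C ⊆ U) (m : ℕ) {δ : ℝ} (hδ : 0 < δ) :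
    ∀ᶠ v : SmoothOn U F in 𝓝 u, ∀ x ∈ C, ‖iteratedFDeriv ℝ m u x - iteratedFDeriv ℝ m v x‖ < δ := by
  have h := ContinuousMap.tendsto_iff_forall_isCompact_tendstoUniformlyOn.1
    ((SmoothOn.continuous_iterDeriv (U := U) (F := F) m).continuousAt (x := u)) ((↑) ⁻¹' C)
    (Topology.IsInducing.subtypeVal.isCompact_preimage_iff (by simpa using hCU) |>.2 hC)
  filter_upwards [Metric.tendstoUniformlyOn_iff.1 h δ hδ] with v hv x hx
  rw [← dist_eq_norm]
  exact hv ⟨x, hCU hx⟩ hx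

theorem SmoothOn.continuous_of_forall_exists_bound (L : SmoothOn U F →ₗ[ℝ] SmoothOn V G)
    (h : ∀ (m : ℕ) (C : Set E), IsCompact C → C ⊆ V → ∃ C' : Set E, IsCompact C' ∧ C' ⊆ U ∧
      ∃ A, ∀ u : SmoothOn U F, ∀ M, (∀ j ≤ m, ∀ y ∈ C', ‖iteratedFDeriv ℝ j u y‖ ≤ M) →
        ∀ x ∈ C, ‖iteratedFDeriv ℝ m (L u) x‖ ≤ A * M) : Continuous L := by
  refine continuous_iInf_rng.2 fun m => continuous_induced_rng.2
    (continuous_iff_continuousAt.2 fun u => ?_)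
  refine ContinuousMap.tendsto_iff_forall_isCompact_tendstoUniformlyOn.2 fun K hK => ?_
  rw [Metric.tendstoUniformlyOn_iff]
  intro η hη
  obtain ⟨C', hC', hC'U, A, hA⟩ := h m _ (hK.image continuous_subtype_val)
    (by rintro _ ⟨x, -, rfl⟩; exact x.2)
  -- The `+ 1` makes the quotient meaningful when `A = 0` and the final inequality strict.
  have hδ : 0 < η / (|A| + 1) := by positivity
  have hev := (Finset.range (m + 1)).eventually_all.2 fun j _ =>
    u.eventually_dist_iteratedFDeriv_lt hC' hC'U j hδ
  filter_upwards [hev] with v hv x hx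
  have h1 := hA (u - v) (η / (|A| + 1)) (fun j hj y hy => by
    rw [SmoothOn.iterDeriv_sub j u v (hC'U hy)]
    exact (hv j (Finset.mem_range.2 (Nat.lt_succ_of_le hj)) y hy).le) x ⟨x, hx, rfl⟩
  rw [map_sub, SmoothOn.iterDeriv_sub m (L u) (L v) x.2, ← dist_eq_norm] at h1
  refine lt_of_le_of_lt h1 ?_
  calc A * (η / (|A| + 1)) ≤ |A| * (η / (|A| + 1)) := by gcongr; exact le_abs_self A
    _ < (|A| + 1) * (η / (|A| + 1)) := by gcongr; linarith
    _ = η := mul_div_cancel₀ _ (by positivity)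

end SmoothOnTopology

/-! ### The operators as continuous linear maps on each function space. -/

section Operators

variable {n k ℓ : ℕ} {θ : EuclideanSpace ℝ (Fin n) → ℝ}

theorem exists_poincareOp_smoothOn (hn : n = k + ℓ + 1) (hθ : ContDiff ℝ ∞ θ)
    (hθc : HasCompactSupport θ) (Ω : Opens (EuclideanSpace ℝ (Fin n)))
    (hΩ : ∀ x ∈ Ω, ∀ z ∈ tsupport θ, ∀ s ∈ Set.Icc (0 : ℝ) 1, x + s • (z - x) ∈ Ω) :
    ∃ R : SmoothOn Ω (AltForm n (ℓ + 1)) →L[ℝ] SmoothOn Ω (AltForm n ℓ),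
      ∀ u : SmoothOn Ω (AltForm n (ℓ + 1)), ∀ x ∈ Ω,
        Integrable (poincareIntegrand θ u x) ∧ R u x = poincareOp θ u x := by
  have hK : IsCompact (Set.Icc (0 : ℝ) 1 ×ˢ tsupport θ) := isCompact_Icc.prod hθc.isCompact
  have hint (u : SmoothOn Ω (AltForm n (ℓ + 1))) {x} (hx : x ∈ Ω) :
      Integrable (poincareIntegrand θ u x) :=
    integrable_poincareIntegrand_of_continuousOn Ω.isOpen hΩ hn hθ.continuous hθc
      u.contDiffOn.continuousOn hx
  have hΨ := contDiff_segmentKernel (c := contraction n ℓ) (ℓ := ℓ) (ε := 1) hθ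
  have ha : ContDiff ℝ ∞ (fun p : ℝ × EuclideanSpace ℝ (Fin n) => ((1 : ℝ) * p.1) • p.2) := by
    fun_prop
  have hs : ContDiff ℝ ∞ (fun p : ℝ × EuclideanSpace ℝ (Fin n) => 1 - (1 : ℝ) * p.1) := by
    fun_prop
  have hUV : ∀ x ∈ Ω, ∀ p ∈ Set.Icc (0 : ℝ) 1 ×ˢ tsupport θ,
      ((1 : ℝ) * p.1) • p.2 + (1 - (1 : ℝ) * p.1) • x ∈ Ω := by
    intro x hx p hp
    convert hΩ x hx p.2 hp.2 p.1 hp.1 using 1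
    module
  have heq (u : SmoothOn Ω (AltForm n (ℓ + 1))) : Set.EqOn (poincareOp θ u)
      (affineSuperposition volume (segmentKernel (contraction n ℓ) θ ℓ 1) (fun p => ((1 : ℝ) * p.1) • p.2)
        (fun p => 1 - (1 : ℝ) * p.1) (Set.Icc (0 : ℝ) 1 ×ˢ tsupport θ) u) Ω := fun x hx => by
    rw [poincareOp_eq_of_continuousOn Ω.isOpen hΩ hn hθ.continuous hθc
      u.contDiffOn.continuousOn hx, setIntegral_segmentIntegrand_eq]
  have hadd (u v : SmoothOn Ω (AltForm n (ℓ + 1))) (x) (hx : x ∈ (Ω : Set _)) :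
      poincareOp θ (u + v : SmoothOn Ω (AltForm n (ℓ + 1))) x =
        (poincareOp θ u + poincareOp θ v) x := by
    change ∫ y, poincareIntegrand θ (u.1 + v.1) x y = _
    rw [poincareIntegrand_add]
    exact integral_add (hint u hx) (hint v hx)
  have hsmul (c : ℝ) (u : SmoothOn Ω (AltForm n (ℓ + 1))) (x) (_ : x ∈ (Ω : Set _)) :
      poincareOp θ (c • u : SmoothOn Ω (AltForm n (ℓ + 1))) x = c • poincareOp θ u x := by
    change ∫ y, poincareIntegrand θ (c • u.1) x y = _
    rw [poincareIntegrand_smul]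
    exact integral_smul c _
  let L : SmoothOn Ω (AltForm n (ℓ + 1)) →ₗ[ℝ] SmoothOn Ω (AltForm n ℓ) :=
    { toFun := fun u => ⟨(Ω : Set (EuclideanSpace ℝ (Fin n))).indicator (poincareOp θ u),
        ((contDiffOn_affineSuperposition hΨ ha hs hK Ω.isOpen Ω.isOpen hUV
          u.contDiffOn).congr (heq u)).congr fun x hx => Set.indicator_of_mem hx _,
        fun x hx => Set.indicator_of_notMem hx _⟩
      map_add' := fun u v => Subtype.ext
        ((Set.indicator_congr (hadd u v)).trans (Set.indicator_add' _ _ _))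
      map_smul' := fun c u => Subtype.ext
        ((Set.indicator_congr (hsmul c u)).trans (Set.indicator_const_smul _ c _)) }
  have hL (u : SmoothOn Ω (AltForm n (ℓ + 1))) {x} (hx : x ∈ Ω) : L u x = poincareOp θ u x :=
    Set.indicator_of_mem (show x ∈ (Ω : Set _) from hx) _
  refine ⟨⟨L, SmoothOn.continuous_of_forall_exists_bound L fun m C hC hCΩ => ?_⟩,
    fun u x hx => ⟨hint u hx, hL u hx⟩⟩
  -- The compact set controlling `C` is the union of all segments from `C` to the support of `θ`.
  refine ⟨_, isCompact_image_segment hC hθc.isCompact, ?_, ?_⟩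
  · rintro _ ⟨⟨x, z, s⟩, ⟨hx, hz, hs⟩, rfl⟩
    exact hΩ x (hCΩ hx) z hz s hs
  · obtain ⟨A, -, hA⟩ := exists_norm_iteratedFDeriv_affineSuperposition_le (μ := volume)
      hΨ ha hs hK Ω.isOpen Ω.isOpen hUV hC hCΩ m
    refine ⟨A, fun u M hM x hx => ?_⟩
    -- The two functions agree only on `Ω`; as `Ω` is open, they have the same germ at `x`, hence
    -- the same derivatives.
    have hev : (L u : EuclideanSpace ℝ (Fin n) → AltForm n ℓ) =ᶠ[𝓝 x]
        affineSuperposition volume (segmentKernel (contraction n ℓ) θ ℓ 1) (fun p => ((1 : ℝ) * p.1) • p.2)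
          (fun p => 1 - (1 : ℝ) * p.1) (Set.Icc (0 : ℝ) 1 ×ˢ tsupport θ) u := by
      filter_upwards [Ω.isOpen.mem_nhds (hCΩ hx)] with y hy
      rw [hL u hy, heq u hy]
    rw [(hev.iteratedFDeriv ℝ m).eq_of_nhds]
    refine hA u u.contDiffOn M (fun j hj y hy p hp => ?_) x hx
    refine hM j hj _ ⟨(y, p.2, p.1), ⟨hy, hp.2, hp.1⟩, ?_⟩
    simp only
    module

/-- By locality, the operators on the whole space and on `Ω` commute with restriction. So the image
of a form extendable from `Ω` is again extendable, and continuity descends to the quotient topology.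
-/
theorem exists_poincareOp_smoothUpToBoundary (hn : n = k + ℓ + 1) (hθ : ContDiff ℝ ∞ θ)
    (hθc : HasCompactSupport θ) (Ω : Opens (EuclideanSpace ℝ (Fin n)))
    (hΩ : ∀ x ∈ Ω, ∀ z ∈ tsupport θ, ∀ s ∈ Set.Icc (0 : ℝ) 1, x + s • (z - x) ∈ Ω) :
    ∃ R : SmoothUpToBoundary Ω (AltForm n (ℓ + 1)) →L[ℝ] SmoothUpToBoundary Ω (AltForm n ℓ),
      ∀ u : SmoothUpToBoundary Ω (AltForm n (ℓ + 1)), ∀ x ∈ Ω,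
        Integrable (poincareIntegrand θ u x) ∧ R u x = poincareOp θ u x := by
  obtain ⟨R, hR⟩ := exists_poincareOp_smoothOn (ℓ := ℓ) hn hθ hθc Ω hΩ
  obtain ⟨R', hR'⟩ := exists_poincareOp_smoothOn (ℓ := ℓ) hn hθ hθc ⊤
    fun _ _ _ _ _ _ => Opens.mem_top _
  have hcomm (w : SmoothOn (⊤ : Opens (EuclideanSpace ℝ (Fin n))) (AltForm n (ℓ + 1))) :
      SmoothOn.restrict Ω (R' w) = R (SmoothOn.restrict Ω w) := by
    refine Subtype.ext (funext fun x => ?_)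
    by_cases hx : x ∈ Ω
    · have h1 : (SmoothOn.restrict Ω (R' w)).1 x = R' w x :=
        Set.indicator_of_mem (show x ∈ (Ω : Set _) from hx) _
      rw [h1, (hR' w x (Opens.mem_top x)).2]
      refine Eq.trans ?_ (hR (SmoothOn.restrict Ω w) x hx).2.symm
      rw [poincareOp, poincareOp, poincareIntegrand_congr (v := SmoothOn.restrict Ω w)]
      intro z hz s hs
      exact (Set.indicator_of_mem (show x + s • (z - x) ∈ (Ω : Set _) from hΩ x hx z hz s hs)
        _).symm
    · exact ((SmoothOn.restrict Ω (R' w)).2.2 x hx).trans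
        ((R (SmoothOn.restrict Ω w)).2.2 x hx).symm
  let L : SmoothUpToBoundary Ω (AltForm n (ℓ + 1)) →ₗ[ℝ] SmoothUpToBoundary Ω (AltForm n ℓ) :=
    { toFun := fun u => ⟨R u.1, by
        obtain ⟨w, hw⟩ := u.2
        exact ⟨R' w, by rw [hcomm, hw]⟩⟩
      map_add' := fun u v => Subtype.ext (map_add R u.1 v.1)
      map_smul' := fun c u => Subtype.ext (map_smul R c u.1) }
  have hLcomm : L ∘ SmoothUpToBoundary.restrict Ω = SmoothUpToBoundary.restrict Ω ∘ R' :=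
    funext fun w => Subtype.ext (hcomm w).symm
  refine ⟨⟨L, continuous_coinduced_dom.2 ?_⟩, fun u x hx => hR u.1 x hx⟩
  change Continuous (L ∘ SmoothUpToBoundary.restrict Ω)
  rw [hLcomm]
  exact continuous_coinduced_rng.comp R'.continuous

theorem bogovskiiOp_eq_affineSuperposition (hn : n = k + ℓ + 1) (hθ : Continuous θ)
    (hθc : HasCompactSupport θ) {u : EuclideanSpace ℝ (Fin n) → AltForm n (ℓ + 1)}
    (hu : Continuous u) {K : Set (EuclideanSpace ℝ (Fin n))}
    (hK : IsCompact K) (huK : ∀ y, y ∉ K → u y = 0) :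
    bogovskiiOp θ u =
      affineSuperposition volume (backwardKernel (contraction n ℓ) θ k ℓ) (fun p => p.2) (fun _ => 0)
        (Set.Icc (1 : ℝ) 2 ×ˢ K) u +
      affineSuperposition volume (segmentKernel (contraction n ℓ) θ ℓ (-1)) (fun p => ((-1 : ℝ) * p.1) • p.2)
        (fun p => 1 - (-1 : ℝ) * p.1) (Set.Icc (0 : ℝ) 1 ×ˢ tsupport θ) u := by
  ext1 x
  rw [bogovskiiOp_eq hn hθ hθc hu hK huK, setIntegral_backwardIntegrand_eq,
    setIntegral_segmentIntegrand_eq]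
  rfl

theorem exists_bogovskiiOp_supportedIn (hn : n = k + ℓ + 1) (hθ : ContDiff ℝ ∞ θ)
    (hθc : HasCompactSupport θ) (K K' : Compacts (EuclideanSpace ℝ (Fin n)))
    (hKK' : ∀ y ∈ K, ∀ z ∈ tsupport θ, ∀ s ∈ Set.Icc (0 : ℝ) 1, y + s • (z - y) ∈ K') :
    ∃ T : 𝓓_{K}(EuclideanSpace ℝ (Fin n), AltForm n (ℓ + 1)) →L[ℝ]
        𝓓_{K'}(EuclideanSpace ℝ (Fin n), AltForm n ℓ),
      ∀ (u : 𝓓_{K}(EuclideanSpace ℝ (Fin n), AltForm n (ℓ + 1))) (x : EuclideanSpace ℝ (Fin n)),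
        Integrable (bogovskiiIntegrand θ u x) ∧ T u x = bogovskiiOp θ u x := by
  have hint (u : 𝓓_{K}(EuclideanSpace ℝ (Fin n), AltForm n (ℓ + 1)))
      (x : EuclideanSpace ℝ (Fin n)) : Integrable (bogovskiiIntegrand θ u x) :=
    integrable_bogovskiiIntegrand hn hθ.continuous hθc u.continuous K.isCompact
      fun y hy => u.zero_on_compl hy
  have heq (u : 𝓓_{K}(EuclideanSpace ℝ (Fin n), AltForm n (ℓ + 1))) :=
    bogovskiiOp_eq_affineSuperposition hn hθ.continuous hθc u.continuous K.isCompact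
      fun y hy => u.zero_on_compl hy
  have hK1 : IsCompact (Set.Icc (1 : ℝ) 2 ×ˢ (K : Set (EuclideanSpace ℝ (Fin n)))) :=
    isCompact_Icc.prod K.isCompact
  have hK2 : IsCompact (Set.Icc (0 : ℝ) 1 ×ˢ tsupport θ) := isCompact_Icc.prod hθc.isCompact
  have hΨ1 := contDiff_backwardKernel (c := contraction n ℓ) (k := k) (ℓ := ℓ) hθ
  have hΨ2 := contDiff_segmentKernel (c := contraction n ℓ) (ℓ := ℓ) (ε := -1) hθ
  have ha1 : ContDiff ℝ ∞ (fun p : ℝ × EuclideanSpace ℝ (Fin n) => p.2) := by fun_prop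
  have hs1 : ContDiff ℝ ∞ (fun _ : ℝ × EuclideanSpace ℝ (Fin n) => (0 : ℝ)) := by fun_prop
  have ha2 : ContDiff ℝ ∞ (fun p : ℝ × EuclideanSpace ℝ (Fin n) => ((-1 : ℝ) * p.1) • p.2) := by
    fun_prop
  have hs2 : ContDiff ℝ ∞ (fun p : ℝ × EuclideanSpace ℝ (Fin n) => 1 - (-1 : ℝ) * p.1) := by
    fun_prop
  have hsm1 (u : 𝓓_{K}(EuclideanSpace ℝ (Fin n), AltForm n (ℓ + 1))) :=
    contDiffOn_univ.1 (contDiffOn_affineSuperposition (μ := volume) hΨ1 ha1 hs1 hK1 isOpen_univ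
      isOpen_univ (fun _ _ _ _ => Set.mem_univ _) u.contDiff.contDiffOn)
  have hsm2 (u : 𝓓_{K}(EuclideanSpace ℝ (Fin n), AltForm n (ℓ + 1))) :=
    contDiffOn_univ.1 (contDiffOn_affineSuperposition (μ := volume) hΨ2 ha2 hs2 hK2 isOpen_univ
      isOpen_univ (fun _ _ _ _ => Set.mem_univ _) u.contDiff.contDiffOn)
  refine ⟨ContDiffMapSupportedIn.mkCLM ℝ (fun u => bogovskiiOp θ u) (fun u v x => ?_)
    (fun c u x => ?_) (fun u => ?_) (fun u x hx => ?_) (fun i _ => ?_), fun u x => ⟨hint u x, rfl⟩⟩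
  · change ∫ y, bogovskiiIntegrand θ (⇑u + ⇑v) x y = _
    rw [bogovskiiIntegrand_add]
    exact integral_add (hint u x) (hint v x)
  · change ∫ y, bogovskiiIntegrand θ (c • ⇑u) x y = _
    rw [bogovskiiIntegrand_smul]
    exact integral_smul c _
  · rw [heq u]
    exact (hsm1 u).add (hsm2 u)
  -- Outside `K'` the integrand vanishes identically: a nonzero kernel would put `x` on a segment
  -- from `K` to the support of `θ`.
  · simp only [bogovskiiOp]
    rw [bogovskiiIntegrand_eq_zero (fun y hy => u.zero_on_compl hy) hKK' hx]
    simp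
  · obtain ⟨A, hA0, hA⟩ := exists_norm_iteratedFDeriv_affineSuperposition_le (μ := volume)
      hΨ1 ha1 hs1 hK1 isOpen_univ isOpen_univ (fun _ _ _ _ => Set.mem_univ _) K'.isCompact
      (Set.subset_univ _) i
    obtain ⟨B, hB0, hB⟩ := exists_norm_iteratedFDeriv_affineSuperposition_le (μ := volume)
      hΨ2 ha2 hs2 hK2 isOpen_univ isOpen_univ (fun _ _ _ _ => Set.mem_univ _) K'.isCompact
      (Set.subset_univ _) i
    refine ⟨Finset.range (i + 1), A + B, by positivity, fun u x hx => ?_⟩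
    have hM (j : ℕ) (hj : j ≤ i) (y : EuclideanSpace ℝ (Fin n)) : ‖iteratedFDeriv ℝ j u y‖ ≤
        ((Finset.range (i + 1)).sup fun j =>
          ContDiffMapSupportedIn.seminorm ℝ (EuclideanSpace ℝ (Fin n)) (AltForm n (ℓ + 1)) ⊤ K j)
            u :=
      (ContDiffMapSupportedIn.norm_iteratedFDeriv_apply_le_seminorm_top ℝ).trans
        (Seminorm.le_def.1 (Finset.le_sup (f := fun j =>
          ContDiffMapSupportedIn.seminorm ℝ (EuclideanSpace ℝ (Fin n)) (AltForm n (ℓ + 1)) ⊤ K j)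
          (Finset.mem_range.2 (Nat.lt_succ_of_le hj))) u)
    rw [heq u, iteratedFDeriv_add_apply
      ((hsm1 u).contDiffAt.of_le (by exact_mod_cast le_top))
      ((hsm2 u).contDiffAt.of_le (by exact_mod_cast le_top)), add_mul]
    exact norm_add_le_of_le (hA u u.contDiff.contDiffOn _ (fun j hj y _ p _ => hM j hj _) x hx)
      (hB u u.contDiff.contDiffOn _ (fun j hj y _ p _ => hM j hj _) x hx)

theorem exists_bogovskiiOp_testFunction (hn : n = k + ℓ + 1) (hθ : ContDiff ℝ ∞ θ)
    (hθc : HasCompactSupport θ) (Ω : Opens (EuclideanSpace ℝ (Fin n)))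
    (hΩ : ∀ x ∈ Ω, ∀ z ∈ tsupport θ, ∀ s ∈ Set.Icc (0 : ℝ) 1, x + s • (z - x) ∈ Ω) :
    ∃ T : 𝓓(Ω, AltForm n (ℓ + 1)) →L[ℝ] 𝓓(Ω, AltForm n ℓ),
      ∀ (u : 𝓓(Ω, AltForm n (ℓ + 1))) (x : EuclideanSpace ℝ (Fin n)),
        Integrable (bogovskiiIntegrand θ u x) ∧ T u x = bogovskiiOp θ u x := by
  let hull (K : Compacts (EuclideanSpace ℝ (Fin n))) : Compacts (EuclideanSpace ℝ (Fin n)) :=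
    ⟨_, isCompact_image_segment K.isCompact hθc.isCompact⟩
  have hhull (K : Compacts (EuclideanSpace ℝ (Fin n))) (hK : (K : Set (EuclideanSpace ℝ (Fin n))) ⊆ Ω) :
      (hull K : Set (EuclideanSpace ℝ (Fin n))) ⊆ Ω := by
    rintro _ ⟨⟨x, z, s⟩, ⟨hx, hz, hs⟩, rfl⟩
    exact hΩ x (hK hx) z hz s hs
  have hT (K : Compacts (EuclideanSpace ℝ (Fin n))) :=
    exists_bogovskiiOp_supportedIn (ℓ := ℓ) hn hθ hθc K (hull K)
      fun y hy z hz s hs => ⟨(y, z, s), ⟨hy, hz, hs⟩, rfl⟩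
  choose T hT using hT
  let supp (u : 𝓓(Ω, AltForm n (ℓ + 1))) : Compacts (EuclideanSpace ℝ (Fin n)) :=
    ⟨tsupport u, u.hasCompactSupport⟩
  let res (u : 𝓓(Ω, AltForm n (ℓ + 1))) :
      𝓓_{supp u}(EuclideanSpace ℝ (Fin n), AltForm n (ℓ + 1)) :=
    .of_support_subset u.contDiff subset_closure
  -- Each `u` is treated on its own support. Continuity on the inductive limit is tested on each
  -- step `K`, where the choices agree because all equal the same integral operator.
  refine ⟨TestFunction.limitCLM ℝ
    (fun u => .ofSupportedIn (hhull (supp u) u.tsupport_subset) (T (supp u) (res u)))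
    (fun K hK => (TestFunction.ofSupportedInCLM ℝ (hhull K hK)).comp (T K)) ?_, fun u x => ?_⟩
  · intro K hK f
    ext1 x
    exact ((hT _ (res (.ofSupportedIn hK f)) x).2).trans (hT K f x).2.symm
  · exact hT (supp u) (res u) x

end Operators

theorem IsStarlike.add_smul_sub_mem {E : Type*} [NormedAddCommGroup E] [NormedSpace ℝ E]
    {Ω B : Set E} (h : IsStarlike Ω B) {x z : E} (hx : x ∈ Ω) (hz : z ∈ B) {s : ℝ}
    (hs : s ∈ Set.Icc (0 : ℝ) 1) : x + s • (z - x) ∈ Ω :=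
  h x hx ((convex_convexHull ℝ ({x} ∪ B)).add_smul_sub_mem
    (subset_convexHull ℝ _ (Or.inl rfl)) (subset_convexHull ℝ _ (Or.inr hz)) hs)

theorem corollary3p3 (n ℓ : ℕ) (hℓ : ℓ + 1 ≤ n)
    (θ : EuclideanSpace ℝ (Fin n) → ℝ) (hθ : ContDiff ℝ ∞ θ) (hθc : HasCompactSupport θ)
    (hθ1 : ∫ x, θ x = 1) :
    (∃ R : SmoothOn (⊤ : Opens (EuclideanSpace ℝ (Fin n))) (AltForm n (ℓ + 1)) →L[ℝ]
          SmoothOn (⊤ : Opens (EuclideanSpace ℝ (Fin n))) (AltForm n ℓ),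
        ∀ (u : SmoothOn (⊤ : Opens (EuclideanSpace ℝ (Fin n))) (AltForm n (ℓ + 1)))
          (x : EuclideanSpace ℝ (Fin n)),
          Integrable (poincareIntegrand θ u x) ∧ R u x = poincareOp θ u x) ∧
    (∃ T : 𝓓((⊤ : Opens (EuclideanSpace ℝ (Fin n))), AltForm n (ℓ + 1)) →L[ℝ]
          𝓓((⊤ : Opens (EuclideanSpace ℝ (Fin n))), AltForm n ℓ),
        ∀ (u : 𝓓((⊤ : Opens (EuclideanSpace ℝ (Fin n))), AltForm n (ℓ + 1)))
          (x : EuclideanSpace ℝ (Fin n)),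
          Integrable (bogovskiiIntegrand θ u x) ∧ T u x = bogovskiiOp θ u x) ∧
    (∀ (Ω : Opens (EuclideanSpace ℝ (Fin n))) (B : Set (EuclideanSpace ℝ (Fin n)))
        (c : EuclideanSpace ℝ (Fin n)) (r : ℝ)
        (hΩ : Bornology.IsBounded (Ω : Set (EuclideanSpace ℝ (Fin n)))),
      (B = Metric.ball c r ∨ B = Metric.closedBall c r) → tsupport θ ⊆ B →
      IsStarlike (Ω : Set (EuclideanSpace ℝ (Fin n))) B →
      (∃ R : SmoothOn Ω (AltForm n (ℓ + 1)) →L[ℝ] SmoothOn Ω (AltForm n ℓ),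
        ∀ u : SmoothOn Ω (AltForm n (ℓ + 1)), ∀ x ∈ Ω,
          Integrable (poincareIntegrand θ u x) ∧ R u x = poincareOp θ u x) ∧
      (∃ R : SmoothUpToBoundary Ω (AltForm n (ℓ + 1)) →L[ℝ] SmoothUpToBoundary Ω (AltForm n ℓ),
        ∀ u : SmoothUpToBoundary Ω (AltForm n (ℓ + 1)), ∀ x ∈ Ω,
          Integrable (poincareIntegrand θ u x) ∧ R u x = poincareOp θ u x) ∧
      (∃ T : 𝓓(Ω, AltForm n (ℓ + 1)) →L[ℝ] 𝓓(Ω, AltForm n ℓ),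
        ∀ (u : 𝓓(Ω, AltForm n (ℓ + 1))) (x : EuclideanSpace ℝ (Fin n)),
          Integrable (bogovskiiIntegrand θ u x) ∧ T u x = bogovskiiOp θ u x) ∧
      (∃ T : 𝓓_{(⟨closure Ω, hΩ.isCompact_closure⟩ : Compacts (EuclideanSpace ℝ (Fin n)))}(
              EuclideanSpace ℝ (Fin n), AltForm n (ℓ + 1)) →L[ℝ]
            𝓓_{(⟨closure Ω, hΩ.isCompact_closure⟩ : Compacts (EuclideanSpace ℝ (Fin n)))}(
              EuclideanSpace ℝ (Fin n), AltForm n ℓ),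
        ∀ (u : 𝓓_{(⟨closure Ω, hΩ.isCompact_closure⟩ : Compacts (EuclideanSpace ℝ (Fin n)))}(
              EuclideanSpace ℝ (Fin n), AltForm n (ℓ + 1))) (x : EuclideanSpace ℝ (Fin n)),
          Integrable (bogovskiiIntegrand θ u x) ∧ T u x = bogovskiiOp θ u x)) := by
  obtain ⟨k, hk⟩ := Nat.exists_eq_add_of_le hℓ
  have hn : n = k + ℓ + 1 := by omega
  refine ⟨?_, exists_bogovskiiOp_testFunction hn hθ hθc ⊤ fun _ _ _ _ _ _ => Opens.mem_top _, ?_⟩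
  · obtain ⟨R, hR⟩ := exists_poincareOp_smoothOn (ℓ := ℓ) hn hθ hθc ⊤
      fun _ _ _ _ _ _ => Opens.mem_top _
    exact ⟨R, fun u x => hR u x (Opens.mem_top x)⟩
  · intro Ω B c r hΩ _ hθB hstar
    have hseg : ∀ x ∈ Ω, ∀ z ∈ tsupport θ, ∀ s ∈ Set.Icc (0 : ℝ) 1, x + s • (z - x) ∈ Ω :=
      fun x hx z hz s hs => hstar.add_smul_sub_mem hx (hθB hz) hs
    refine ⟨exists_poincareOp_smoothOn hn hθ hθc Ω hseg,
      exists_poincareOp_smoothUpToBoundary hn hθ hθc Ω hseg,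
      exists_bogovskiiOp_testFunction hn hθ hθc Ω hseg,
      exists_bogovskiiOp_supportedIn hn hθ hθc _ _ fun y hy z hz s hs => ?_⟩
    -- For fixed `z` and `s` the homothety is continuous and maps `Ω` into itself, hence also
    -- `closure Ω`.
    exact map_mem_closure (f := fun y => y + s • (z - y)) (by fun_prop) hy
      fun x hx => hseg x hx z hz s hs
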